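/- Fix $d\ge 1$, $r\in\mathbb R$, $\xi>0$, $\ell_0\in\mathbb N$. Let $\Lambda$ be a finite non-empty set of $n=|\Lambda|$ sites of the $d$-dimensional hypercubic lattice (each coordinate direction either infinite or periodic) with the Manhattan distance $\mathrm{dist}$, and put a $q$-level spin ($q\ge 2$; $q=2$ is spin $1/2$) on each site. Operators act on $(\mathbb C^q)^{\otimes\Lambda}$, $\|\cdot\|$ is the operator norm, and $\mathrm{dist}(X,Y)=\min_{i\in X,j\in Y}\mathrm{dist}(i,j)$. Let $H$ be a Hamiltonian which, up to an additive constant chosen so that its ground-state energy is $0$, is a sum $\sum_{i\in\Lambda}H_i$ with $\|H_i\|\le 1$ and $H_i$ acting only on spins within distance $\ell_0$ of $i$. For $\beta\ge 0$ put $Z_\beta=\mathrm{tr}\,e^{-\beta H}$ and $\rho_\beta=e^{-\beta H}/Z_\beta$. A density matrix $\rho$ has $(r,\xi)$-clustering if $$|\mathrm{tr}(\rho A_XB_Y)-\mathrm{tr}(\rho A_X)\,\mathrm{tr}(\rho B_Y)|\le \|A_X\|\,\|B_Y\|\,e^{-\mathrm{dist}(X,Y)/\xi}$$ for all operators $A_X,B_Y$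 supported on non-empty $X,Y\subseteq\Lambda$ with $\mathrm{dist}(X,Y)\ge r$. Let $\ell\in\mathbb N$ with $\ell\ge r$, and let $\Omega=\sum_{i\in\Lambda}\Omega_i$ be a Hermitian operator with $\|\Omega_i\|\le 1$ and $\Omega_i$ acting only on spins within distance $\ell$ of $i$. Let $\langle O\rangle_\infty=\frac1D\sum_{k<D}\langle\varphi_k|O|\varphi_k\rangle$ be the ground-state average, where $(\varphi_k)_{k<D}$ is an orthonormal basis of the space of ground states of $H$. Theorem 1. (a) There are constants $c_1,c_2>0$ depending only on $d,r,\xi,\ell_0$ such that, for all $\Lambda,q,H,\ell,\Omega$ as above and every inverse temperature $\beta^*\ge 0$ for which $\rho_{\beta^*}$ has $(r,\xi)$-clustering, every normalized eigenvector $|E\rangle$ of $H$ with eigenvalue $E$ (in particular, any superposition of degenerate eigenstates) satisfies $$\bigl|\langle E|\Omega/n|E\rangle-\langle\Omega/n\rangle_\infty\bigr|\le \frac1{\sqrt n}\max\Bigl(c_1\bigl[\beta^*E+\log Z_{\beta^*}\bigr]^{(d+1)/2},\ c_2\bigl[\ell^d(\beta^*E+\log Z_{\beta^*})\bigr]^{1/2}\Bigr).$$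 (b) Consequently, low-lying eigenstates thermalize when $\log Z_{\beta^*}=O(1)$: for every $\ell\ge r$, $C\in\mathbb R$ and $\varepsilon>0$ there are $\delta>0$ and $N$ (depending only on $d,r,\xi,\ell_0,\ell,C,\varepsilon$) such that, in the situation of (a), if $n\ge N$, $\log Z_{\beta^*}\le C$ and $\beta^*E\le\delta\,n^{1/(d+1)}$, then $|\langle E|\Omega/n|E\rangle-\langle\Omega/n\rangle_\infty|\le\varepsilon$. -/

import Mathlib

open scoped Matrix.Norms.L2Operator

noncomputable section

namespace SpinLattice

/-! ### Lattice geometry -/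

/-- Sites of the `d`-dimensional hypercubic lattice. Direction `k` is periodic with period `m k`
when `m k ≠ 0`; since `ZMod 0 = ℤ`, direction `k` is the infinite (non-periodic) one when
`m k = 0`. In particular `m = 0` is the lattice `ℤ ^ d`. -/
abbrev Site {d : ℕ} (m : Fin d → ℕ) : Type := ∀ k : Fin d, ZMod (m k)

/-- Manhattan distance. `ZMod.valMinAbs` is the representative of least absolute value (and the
identity on `ZMod 0 = ℤ`). -/
def manhattan {d : ℕ} {m : Fin d → ℕ} (x y : Site m) : ℕ :=
  ∑ k, ((x k - y k).valMinAbs).natAbs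

/-- Distance between two sets of sites: the minimum of the distances of their elements. -/
def setDist {d : ℕ} {m : Fin d → ℕ} {Λ : Finset (Site m)} (X Y : Set Λ) : ℕ :=
  sInf {δ : ℕ | ∃ i ∈ X, ∃ j ∈ Y, δ = manhattan (i : Site m) (j : Site m)}

/-- Sites of `Λ` at distance at most `s` from `i`. -/
def ball {d : ℕ} {m : Fin d → ℕ} {Λ : Finset (Site m)} (i : Λ) (s : ℕ) : Set Λ :=
  {j | manhattan (i : Site m) (j : Site m) ≤ s}

/-! ### Operators and states of a system of `q`-level spins on a finite set of sites `Λ` -/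

/-- Classical configurations; they label the product basis of `⨂_{i ∈ Λ} ℂ ^ q`. -/
abbrev Config {d : ℕ} {m : Fin d → ℕ} (Λ : Finset (Site m)) (q : ℕ) : Type := Λ → Fin q

/-- Pure state vectors. -/
abbrev State {d : ℕ} {m : Fin d → ℕ} (Λ : Finset (Site m)) (q : ℕ) : Type :=
  EuclideanSpace ℂ (Config Λ q)

/-- Operators, as matrices in the product basis; their norm `‖·‖` is the operator norm. -/
abbrev Operator {d : ℕ} {m : Fin d → ℕ} (Λ : Finset (Site m)) (q : ℕ) : Type :=
  Matrix (Config Λ q) (Config Λ q) ℂ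

open Classical in
/-- `A` is supported on `X`: it is of the form `a ⊗ 1` with `a` acting on the spins in `X`
and the identity acting on the spins outside `X`. -/
def SupportedOn {d : ℕ} {m : Fin d → ℕ} {Λ : Finset (Site m)} {q : ℕ}
    (X : Set Λ) (A : Operator Λ q) : Prop :=
  ∃ a : Matrix (X → Fin q) (X → Fin q) ℂ, ∀ σ τ : Config Λ q,
    A σ τ = if ∀ i, i ∉ X → σ i = τ i then a (fun i => σ i) (fun i => τ i) else 0

/-- `A` is a sum of terms `A_i`, `i ∈ Λ`, with `‖A_i‖ ≤ 1` and `A_i` acting only on the spins at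
distance at most `s` from `i`. -/
def IsLocalSum {d : ℕ} {m : Fin d → ℕ} {Λ : Finset (Site m)} {q : ℕ}
    (s : ℕ) (A : Operator Λ q) : Prop :=
  ∃ a : Λ → Operator Λ q, (∀ i, SupportedOn (ball i s) (a i) ∧ ‖a i‖ ≤ 1) ∧ A = ∑ i, a i

/-- A macroscopic observable made of local terms of range `ℓ`. -/
def IsMacroscopicObservable {d : ℕ} {m : Fin d → ℕ} {Λ : Finset (Site m)} {q : ℕ}
    (ℓ : ℕ) (Ω : Operator Λ q) : Prop :=
  Ω.IsHermitian ∧ IsLocalSum ℓ Ω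

/-- The real number `E` is an eigenvalue (energy level) of `H`. -/
def IsEnergy {d : ℕ} {m : Fin d → ℕ} {Λ : Finset (Site m)} {q : ℕ}
    (H : Operator Λ q) (E : ℝ) : Prop :=
  Module.End.HasEigenvalue (Matrix.toEuclideanLin H) (E : ℂ)

/-- A local Hamiltonian of range `ℓ₀`, whose energy is measured from the ground state:
`H` is a sum of local terms up to a constant shift `e`, and its least eigenvalue is `0`. -/
def IsLocalHamiltonian {d : ℕ} {m : Fin d → ℕ} {Λ : Finset (Site m)} {q : ℕ}
    (ℓ₀ : ℕ) (H : Operator Λ q) : Prop :=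
  H.IsHermitian ∧ (∃ e : ℝ, IsLocalSum ℓ₀ (H + (e : ℂ) • 1)) ∧ IsLeast {E : ℝ | IsEnergy H E} 0

/-- `ψ` is a normalized eigenvector of `H` with energy `E`. -/
def IsEigenstate {d : ℕ} {m : Fin d → ℕ} {Λ : Finset (Site m)} {q : ℕ}
    (H : Operator Λ q) (E : ℝ) (ψ : State Λ q) : Prop :=
  ‖ψ‖ = 1 ∧ Matrix.toEuclideanLin H ψ = (E : ℂ) • ψ

/-! ### Averages -/

/-- The expectation value `⟨ψ|O|ψ⟩`. -/
def expectation {d : ℕ} {m : Fin d → ℕ} {Λ : Finset (Site m)} {q : ℕ}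
    (ψ : State Λ q) (O : Operator Λ q) : ℂ :=
  inner ℂ ψ (Matrix.toEuclideanLin O ψ)

/-- The partition function `Z_β = tr e^{-βH}`. -/
def partitionFunction {d : ℕ} {m : Fin d → ℕ} {Λ : Finset (Site m)} {q : ℕ}
    (H : Operator Λ q) (β : ℝ) : ℝ :=
  (Matrix.trace (NormedSpace.exp (-(β : ℂ) • H))).re

/-- The canonical state `ρ_β = e^{-βH} / Z_β`. -/
def canonicalState {d : ℕ} {m : Fin d → ℕ} {Λ : Finset (Site m)} {q : ℕ}
    (H : Operator Λ q) (β : ℝ) : Operator Λ q :=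
  ((partitionFunction H β : ℂ)⁻¹) • NormedSpace.exp (-(β : ℂ) • H)

/-- `(r, ξ)`-clustering of a density matrix `ρ`. -/
def IsClustering {d : ℕ} {m : Fin d → ℕ} {Λ : Finset (Site m)} {q : ℕ}
    (r ξ : ℝ) (ρ : Operator Λ q) : Prop :=
  ∀ X Y : Set Λ, X.Nonempty → Y.Nonempty → r ≤ (setDist X Y : ℝ) →
    ∀ A B : Operator Λ q, SupportedOn X A → SupportedOn Y B →
      ‖Matrix.trace (ρ * (A * B)) - Matrix.trace (ρ * A) * Matrix.trace (ρ * B)‖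
        ≤ ‖A‖ * ‖B‖ * Real.exp (-(setDist X Y : ℝ) / ξ)

/-- The space of ground states of a Hamiltonian with ground-state energy `0`. -/
def groundSpace {d : ℕ} {m : Fin d → ℕ} {Λ : Finset (Site m)} {q : ℕ}
    (H : Operator Λ q) : Submodule ℂ (State Λ q) :=
  Module.End.eigenspace (Matrix.toEuclideanLin H) 0

/-- The ground-state average `⟨O⟩_∞ = D⁻¹ ∑_{k < D} ⟨φ_k|O|φ_k⟩`, with `φ_0, …, φ_{D-1}` an
orthonormal basis of the space of ground states (the value does not depend on the basis). -/
def groundAverage {d : ℕ} {m : Fin d → ℕ} {Λ : Finset (Site m)} {q : ℕ}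
    (H : Operator Λ q) (O : Operator Λ q) : ℂ :=
  ((Module.finrank ℂ (groundSpace H) : ℂ)⁻¹) *
    ∑ k, expectation (stdOrthonormalBasis ℂ (groundSpace H) k : State Λ q) O

end SpinLattice

end

/-! An eigenstate and every ground state are compared with the canonical state at the same
temperature. Since `e^{-βH}` is positive and `ψ` is an eigenvector, `⟨Y⟩_ψ ^ (2p) ≤ e^{βE} Z tr (ρ Y
^ (2p))` for Hermitian `Y` and `p` a power of two (`norm_expectation_pow_le`). Take `Y = Ω - tr (ρ
Ω)`, write `x = βE + log Z` and choose `p` between `x` and `2x`: the prefactor `e^x ≤ e^p` costs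
only a constant after the `p`-th root.

What remains is the moment bound `tr (ρ Y ^ (2p)) ≤ (c n p max(ℓ, p)^d)^p`
(`IsClustering.norm_trace_sum_pow_le`). Expand the power over `2p`-tuples of centered local terms.
If one factor is farther by `L` from all others than their ranges require, clustering makes the
trace of order `e^{-L/ξ}`. Tuples without a factor isolated beyond scale `L` are few: half of the
entries dominate the rest (`card_clustered_le`). Half of the exponential decay absorbs the volume
factors, and the other half is summed over `L`.

The choice of `p` needs `x` bounded below. Either `ψ` is the unique ground state and the difference
vanishes, or two orthogonal eigenvectors force `x ≥ log 2` (`log_two_le_of_orthogonal`). -/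

namespace SpinLattice

/-! ### Geometry of the lattice -/

section Lattice

variable {d : ℕ} {m : Fin d → ℕ}

theorem manhattan_self (x : Site m) : manhattan x x = 0 := by
  simp [manhattan]

theorem manhattan_comm (x y : Site m) : manhattan x y = manhattan y x := by
  unfold manhattan
  refine Finset.sum_congr rfl fun k _ => ?_
  rw [← neg_sub (y k) (x k), ZMod.natAbs_valMinAbs_neg]

theorem manhattan_triangle (x y z : Site m) :
    manhattan x z ≤ manhattan x y + manhattan y z := by
  unfold manhattan
  rw [← Finset.sum_add_distrib]
  refine Finset.sum_le_sum fun k _ => ?_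
  have h := ZMod.natAbs_valMinAbs_add_le (x k - y k) (y k - z k)
  rw [sub_add_sub_cancel] at h
  exact h.trans (Int.natAbs_add_le _ _)

/-- A ball of radius `R` contains at most `(2 R + 1) ^ d` sites. -/
theorem card_ball_le (Λ : Finset (Site m)) (x : Λ) (R : ℕ) :
    (Finset.univ.filter fun y : Λ => manhattan (x : Site m) (y : Site m) ≤ R).card
      ≤ (2 * R + 1) ^ d := by
  classical
  have key : (Finset.univ.filter fun y : Λ => manhattan (x : Site m) (y : Site m) ≤ R).card
      ≤ (Fintype.piFinset fun _ : Fin d => Finset.Icc (-(R : ℤ)) R).card := by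
    -- The least absolute representatives of `x - y` embed the ball into the cube `[-R, R]^d`.
    refine Finset.card_le_card_of_injOn
      (fun y k => ((x : Site m) k - (y : Site m) k).valMinAbs) ?_ ?_
    · intro y hy
      have hy : manhattan (x : Site m) (y : Site m) ≤ R := by simpa using hy
      simp only [Finset.mem_coe, Fintype.mem_piFinset, Finset.mem_Icc]
      intro k
      have h1 : (((x : Site m) k - (y : Site m) k).valMinAbs).natAbs ≤ R :=
        (Finset.single_le_sum (f := fun k => (((x : Site m) k - (y : Site m) k).valMinAbs).natAbs)
          (fun _ _ => Nat.zero_le _) (Finset.mem_univ k)).trans hy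
      omega
    · intro y _ z _ h
      refine Subtype.ext (funext fun k => ?_)
      have h1 := ZMod.injective_valMinAbs (congrFun h k)
      exact sub_right_injective h1
  refine key.trans (le_of_eq ?_)
  rw [Fintype.card_piFinset]
  simp only [Int.card_Icc, Finset.prod_const, Finset.card_univ, Fintype.card_fin]
  congr 1
  omega

theorem le_setDist {Λ : Finset (Site m)} {X Y : Set Λ} (hX : X.Nonempty) (hY : Y.Nonempty) {L : ℕ}
    (h : ∀ i ∈ X, ∀ j ∈ Y, L ≤ manhattan (i : Site m) (j : Site m)) : L ≤ setDist X Y := by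
  obtain ⟨i, hi⟩ := hX
  obtain ⟨j, hj⟩ := hY
  refine le_csInf ⟨_, i, hi, j, hj, rfl⟩ ?_
  rintro δ ⟨i, hi, j, hj, rfl⟩
  exact h i hi j hj

end Lattice

/-! ### Algebra of supports -/

section Support

variable {d : ℕ} {m : Fin d → ℕ} {Λ : Finset (Site m)} {q : ℕ}

/-- Replaces the unknown block `a` by conditions on matrix elements, which are easier to carry
through products. -/
theorem supportedOn_iff (hq : 0 < q) {X : Set Λ} {A : Operator Λ q} :
    SupportedOn X A ↔ (∀ σ τ, A σ τ ≠ 0 → ∀ i, i ∉ X → σ i = τ i) ∧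
      ∀ σ τ σ' τ', (∀ i, i ∉ X → σ i = τ i) → (∀ i, i ∉ X → σ' i = τ' i) →
        (∀ i, i ∈ X → σ i = σ' i) → (∀ i, i ∈ X → τ i = τ' i) → A σ τ = A σ' τ' := by
  classical
  constructor
  · rintro ⟨a, ha⟩
    refine ⟨fun σ τ h => ?_, fun σ τ σ' τ' h h' hσ hτ => ?_⟩
    · by_contra hc
      exact h (by rw [ha, if_neg hc])
    · rw [ha, ha, if_pos h, if_pos h']
      congr 1
      · exact funext fun i => hσ i i.2
      · exact funext fun i => hτ i i.2
  · rintro ⟨h1, h2⟩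
    -- The filler value off `X` is arbitrary, because the entries do not depend on the common spins
    -- there; its existence is where `0 < q` enters.
    let ext : (X → Fin q) → Config Λ q := fun s i => if hi : i ∈ X then s ⟨i, hi⟩ else ⟨0, hq⟩
    refine ⟨fun s t => A (ext s) (ext t), fun σ τ => ?_⟩
    split_ifs with h
    · refine h2 _ _ _ _ h ?_ ?_ ?_
      · intro i hi
        simp [ext, hi]
      · intro i hi
        simp [ext, hi]
      · intro i hi
        simp [ext, hi]
    · by_contra hc
      exact h (h1 _ _ hc)

theorem SupportedOn.mono (hq : 0 < q) {X Y : Set Λ} (hXY : X ⊆ Y) {A : Operator Λ q}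
    (hA : SupportedOn X A) : SupportedOn Y A := by
  rw [supportedOn_iff hq] at hA ⊢
  refine ⟨fun σ τ h i hi => hA.1 σ τ h i fun hX => hi (hXY hX), fun σ τ σ' τ' h h' hσ hτ => ?_⟩
  by_cases hc : ∀ i, i ∉ X → σ i = τ i
  · refine hA.2 _ _ _ _ hc (fun i hi => ?_) (fun i hi => hσ i (hXY hi)) fun i hi => hτ i (hXY hi)
    by_cases hiY : i ∈ Y
    · rw [← hσ i hiY, ← hτ i hiY, hc i hi]
    · exact h' i hiY
  -- A disagreement off `X` lies inside `Y`, so the primed pair inherits it and both entries vanish.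
  · have hc' : ¬ ∀ i, i ∉ X → σ' i = τ' i := by
      intro hc'
      refine hc fun i hi => ?_
      by_cases hiY : i ∈ Y
      · rw [hσ i hiY, hτ i hiY, hc' i hi]
      · exact h i hiY
    have e1 : A σ τ = 0 := by
      by_contra h0
      exact hc (hA.1 _ _ h0)
    have e2 : A σ' τ' = 0 := by
      by_contra h0
      exact hc' (hA.1 _ _ h0)
    rw [e1, e2]

theorem SupportedOn.sub {X : Set Λ} {A B : Operator Λ q}
    (hA : SupportedOn X A) (hB : SupportedOn X B) : SupportedOn X (A - B) := by
  classical
  obtain ⟨a, ha⟩ := hA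
  obtain ⟨b, hb⟩ := hB
  refine ⟨a - b, fun σ τ => ?_⟩
  rw [Matrix.sub_apply, ha, hb]
  split_ifs <;> simp

theorem supportedOn_smul_one (X : Set Λ) (c : ℂ) : SupportedOn X (c • (1 : Operator Λ q)) := by
  classical
  refine ⟨c • 1, fun σ τ => ?_⟩
  have key : σ = τ ↔ (∀ i, i ∉ X → σ i = τ i) ∧
      (fun i : X => σ i) = fun i : X => τ i := by
    refine ⟨fun h => ⟨fun i _ => congrFun h i, funext fun i => congrFun h i⟩, fun h => ?_⟩
    funext i
    by_cases hi : i ∈ X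
    · exact congrFun h.2 ⟨i, hi⟩
    · exact h.1 i hi
  by_cases h : ∀ i, i ∉ X → σ i = τ i
  · rw [if_pos h, Matrix.smul_apply, Matrix.smul_apply, Matrix.one_apply, Matrix.one_apply]
    congr 1
    exact if_congr (key.trans (and_iff_right h)) rfl rfl
  · rw [if_neg h, Matrix.smul_apply, Matrix.one_apply_ne fun he => h (key.1 he).1, smul_zero]

theorem SupportedOn.mul (hq : 0 < q) {X : Set Λ} {A B : Operator Λ q}
    (hA : SupportedOn X A) (hB : SupportedOn X B) : SupportedOn X (A * B) := by
  classical
  rw [supportedOn_iff hq] at hA hB ⊢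
  refine ⟨fun σ τ h i hi => ?_, fun σ τ σ' τ' h h' hσ hτ => ?_⟩
  · rw [Matrix.mul_apply] at h
    obtain ⟨κ, _, hκ⟩ := Finset.exists_ne_zero_of_sum_ne_zero h
    exact (hA.1 _ _ (left_ne_zero_of_mul hκ) i hi).trans (hB.1 _ _ (right_ne_zero_of_mul hκ) i hi)
  · simp only [Matrix.mul_apply]
    -- A contributing intermediate configuration agrees with `σ` off `X`; overwriting these spins by
    -- those of `σ'` matches the two sums.
    refine Finset.sum_bij_ne_zero (fun κ _ _ i => if i ∈ X then κ i else σ' i)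
      (fun _ _ _ => Finset.mem_univ _) ?_ ?_ ?_
    · intro κ _ hκ κ' _ hκ' he
      funext i
      by_cases hi : i ∈ X
      · simpa [hi] using congrFun he i
      · rw [← hA.1 _ _ (left_ne_zero_of_mul hκ) i hi, ← hA.1 _ _ (left_ne_zero_of_mul hκ') i hi]
    · intro κ _ hκ
      have hA1 := hA.1 _ _ (left_ne_zero_of_mul hκ)
      have hB1 := hB.1 _ _ (right_ne_zero_of_mul hκ)
      refine ⟨fun i => if i ∈ X then κ i else σ i, Finset.mem_univ _, ?_, ?_⟩
      · have e1 : A σ (fun i => if i ∈ X then κ i else σ i) = A σ' κ :=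
          hA.2 _ _ _ _ (fun i hi => by simp [hi]) hA1 hσ fun i hi => by simp [hi]
        have e2 : B (fun i => if i ∈ X then κ i else σ i) τ = B κ τ' :=
          hB.2 _ _ _ _ (fun i hi => by simp [hi, h i hi]) hB1 (fun i hi => by simp [hi]) hτ
        rw [e1, e2]
        exact hκ
      · funext i
        by_cases hi : i ∈ X <;> simp [hi, hA1 i]
    · intro κ _ hκ
      have hA1 := hA.1 _ _ (left_ne_zero_of_mul hκ)
      have hB1 := hB.1 _ _ (right_ne_zero_of_mul hκ)
      congr 1
      · exact hA.2 _ _ _ _ hA1 (fun i hi => by simp [hi]) hσ fun i hi => by simp [hi]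
      · exact hB.2 _ _ _ _ hB1 (fun i hi => by simp [hi, h' i hi]) (fun i hi => by simp [hi]) hτ

/-- Matrix elements of a product of operators with disjoint supports. -/
theorem SupportedOn.mul_apply_of_disjoint (hq : 0 < q) {X Y : Set Λ} (hXY : Disjoint X Y)
    {A B : Operator Λ q} (hA : SupportedOn X A) (hB : SupportedOn Y B) (σ τ : Config Λ q)
    (κ : Config Λ q) (hκX : ∀ i ∈ X, κ i = τ i) (hκ : ∀ i, i ∉ X → κ i = σ i) :
    (A * B) σ τ = A σ κ * B κ τ := by
  classical
  rw [supportedOn_iff hq] at hA hB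
  rw [Matrix.mul_apply]
  refine Finset.sum_eq_single κ (fun κ' _ hne => ?_) fun h => (h (Finset.mem_univ _)).elim
  by_contra h0
  refine hne (funext fun i => ?_)
  by_cases hi : i ∈ X
  · rw [hκX i hi]
    exact hB.1 _ _ (right_ne_zero_of_mul h0) i (Set.disjoint_left.1 hXY hi)
  · rw [hκ i hi]
    exact (hA.1 _ _ (left_ne_zero_of_mul h0) i hi).symm

/-- In either order a single intermediate configuration contributes, and the two resulting products
have the same factors. -/
theorem SupportedOn.commute (hq : 0 < q) {X Y : Set Λ} (hXY : Disjoint X Y) {A B : Operator Λ q}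
    (hA : SupportedOn X A) (hB : SupportedOn Y B) : Commute A B := by
  classical
  ext σ τ
  rw [hA.mul_apply_of_disjoint hq hXY hB σ τ (fun i => if i ∈ X then τ i else σ i)
      (fun i hi => by simp [hi]) (fun i hi => by simp [hi]),
    hB.mul_apply_of_disjoint hq hXY.symm hA σ τ (fun i => if i ∈ Y then τ i else σ i)
      (fun i hi => by simp [hi]) (fun i hi => by simp [hi])]
  by_cases hc : ∀ i, i ∉ X → i ∉ Y → σ i = τ i
  · rw [mul_comm]
    rw [supportedOn_iff hq] at hA hB
    congr 1
    · refine hB.2 _ _ _ _ ?_ ?_ ?_ ?_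
      · intro i hi
        by_cases hX : i ∈ X <;> simp [hX]
        exact hc i hX hi
      · intro i hi
        simp [hi]
      · intro i hi
        simp [Set.disjoint_right.1 hXY hi]
      · intro i hi
        simp [hi]
    · refine hA.2 _ _ _ _ ?_ ?_ ?_ ?_
      · intro i hi
        simp [hi]
      · intro i hi
        by_cases hY : i ∈ Y <;> simp [hY]
        exact hc i hi hY
      · intro i hi
        simp [Set.disjoint_left.1 hXY hi]
      · intro i hi
        simp [hi]
  -- If `σ` and `τ` differ off `X ∪ Y`, both products vanish.
  · push Not at hc
    obtain ⟨i, hX, hY, hne⟩ := hc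
    rw [supportedOn_iff hq] at hA hB
    have e1 : B (fun i => if i ∈ X then τ i else σ i) τ = 0 := by
      by_contra h0
      have := hB.1 _ _ h0 i hY
      simp [hX] at this
      exact hne this
    have e2 : A (fun i => if i ∈ Y then τ i else σ i) τ = 0 := by
      by_contra h0
      have := hA.1 _ _ h0 i hX
      simp [hY] at this
      exact hne this
    rw [e1, e2, mul_zero, mul_zero]

theorem SupportedOn.list_prod (hq : 0 < q) {X : Set Λ} (l : List (Operator Λ q))
    (h : ∀ A ∈ l, SupportedOn X A) : SupportedOn X l.prod := by
  induction l with
  | nil => simpa using supportedOn_smul_one (q := q) X 1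
  | cons A l ih =>
    rw [List.prod_cons]
    exact (h A (by simp)).mul hq (ih fun B hB => h B (by simp [hB]))

end Support

/-! ### Counting tuples without isolated entries -/

/-- In a symmetric relation without isolated points on `2 p` points, some set of exactly `p` points
dominates all others. -/
theorem exists_dominating_card_eq {p : ℕ} (r : Fin (2 * p) → Fin (2 * p) → Prop)
    (hs : ∀ i j, r i j → r j i) (h : ∀ j, ∃ k, k ≠ j ∧ r j k) :
    ∃ D : Finset (Fin (2 * p)), D.card = p ∧ ∀ j, j ∉ D → ∃ k ∈ D, r j k := by
  classical
  -- A maximal independent set dominates. If it has more than `p` elements, its complement is small,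
  -- and it dominates too: a point of `I` is related to some other point, which cannot lie in `I`.
  obtain ⟨I, hI⟩ := (Set.toFinite {I : Finset (Fin (2 * p)) |
    ∀ i ∈ I, ∀ j ∈ I, i ≠ j → ¬ r i j}).exists_maximal ⟨∅, by simp⟩
  have hind : ∀ i ∈ I, ∀ j ∈ I, i ≠ j → ¬ r i j := hI.prop
  have hdom : ∀ j, j ∉ I → ∃ k ∈ I, r j k := by
    intro j hj
    by_contra! hc
    have hmem : insert j I ∈ {I : Finset (Fin (2 * p)) | ∀ i ∈ I, ∀ j ∈ I, i ≠ j → ¬ r i j} := by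
      intro a ha b hb hab
      rcases Finset.mem_insert.1 ha with rfl | ha' <;> rcases Finset.mem_insert.1 hb with rfl | hb'
      · exact (hab rfl).elim
      · exact hc b hb'
      · exact fun hr => hc a ha' (hs _ _ hr)
      · exact hind a ha' b hb' hab
    exact hj (hI.2 hmem (Finset.subset_insert j I) (Finset.mem_insert_self j I))
  have hex : ∃ D : Finset (Fin (2 * p)), D.card ≤ p ∧ ∀ j, j ∉ D → ∃ k ∈ D, r j k := by
    by_cases hle : I.card ≤ p
    · exact ⟨I, hle, hdom⟩
    · refine ⟨Iᶜ, ?_, fun j hj => ?_⟩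
      · rw [Finset.card_compl, Fintype.card_fin]
        omega
      · have hj : j ∈ I := by simpa using hj
        obtain ⟨k, hk, hr⟩ := h j
        exact ⟨k, by simpa using fun hkI => hind j hj k hkI hk.symm hr, hr⟩
  obtain ⟨D, hD, hd⟩ := hex
  obtain ⟨D', hDD, hcard⟩ := Finset.exists_superset_card_eq hD (by simp; omega)
  refine ⟨D', hcard, fun j hj => ?_⟩
  obtain ⟨k, hk, hr⟩ := hd j fun hj' => hj (hDD hj')
  exact ⟨k, hDD hk, hr⟩

/-- Number of maps for which every index outside `D` is sent near the image of `D`. -/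
theorem card_dominated_le {ι V : Type*} [Fintype ι] [DecidableEq ι] [Fintype V] [DecidableEq V]
    (r : V → V → Prop) [DecidableRel r] {b : ℕ}
    (hb : ∀ v, (Finset.univ.filter fun u => r v u).card ≤ b) (D : Finset ι) :
    (Finset.univ.filter fun f : ι → V => ∀ j, j ∉ D → ∃ k ∈ D, r (f k) (f j)).card
      ≤ Fintype.card V ^ D.card * (D.card * b) ^ (Fintype.card ι - D.card) := by
  classical
  set S := Finset.univ.filter fun f : ι → V => ∀ j, j ∉ D → ∃ k ∈ D, r (f k) (f j)
  have h1 : S.card ≤ ((D.card * b) ^ (Fintype.card ι - D.card)) *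
      (Finset.univ : Finset (D → V)).card := by
    -- Fiber over the restriction to `D`: once those values are fixed, every other entry lies in the
    -- union `U` of their neighborhoods.
    refine Finset.card_le_mul_card_image_of_maps_to (f := fun (f : ι → V) (k : D) => f k)
      (fun _ _ => Finset.mem_univ _) _ fun g _ => ?_
    let U : Finset V := Finset.univ.biUnion fun k : D => Finset.univ.filter fun u => r (g k) u
    have hU : U.card ≤ D.card * b := by
      refine (Finset.card_biUnion_le_card_mul _ _ b fun k _ => hb _).trans ?_
      simp
    have h2 : (S.filter fun f => (fun (k : D) => f k) = g).card
        ≤ (Fintype.piFinset fun _ : {j // j ∉ D} => U).card := by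
      refine Finset.card_le_card_of_injOn (fun f j => f j) ?_ ?_
      · intro f hf
        simp only [S, Finset.coe_filter, Set.mem_ofPred_eq, Finset.mem_filter, Finset.mem_univ,
          true_and] at hf
        simp only [Finset.mem_coe, Fintype.mem_piFinset]
        intro j
        obtain ⟨k, hk, hr⟩ := hf.1 j j.2
        simp only [U, Finset.mem_biUnion, Finset.mem_filter, Finset.mem_univ, true_and]
        refine ⟨⟨k, hk⟩, ?_⟩
        rw [← hf.2]
        exact hr
      · intro f hf f' hf' he
        simp only [Finset.coe_filter, Set.mem_ofPred_eq] at hf hf'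
        funext j
        by_cases hj : j ∈ D
        · exact congrFun (hf.2.trans hf'.2.symm) ⟨j, hj⟩
        · exact congrFun he ⟨j, hj⟩
    refine h2.trans ?_
    rw [Fintype.card_piFinset, Finset.prod_const, Finset.card_univ, Fintype.card_subtype_compl]
    simp only [Fintype.card_coe]
    exact Nat.pow_le_pow_left hU _
  refine h1.trans (le_of_eq ?_)
  rw [mul_comm]
  simp

/-- Number of `2 p`-tuples in which every entry is related to another entry. -/
theorem card_clustered_le {V : Type*} [Fintype V] [DecidableEq V] (r : V → V → Prop)
    [DecidableRel r] (hs : ∀ u v, r u v → r v u) {b : ℕ}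
    (hb : ∀ v, (Finset.univ.filter fun u => r v u).card ≤ b) (p : ℕ) :
    (Finset.univ.filter fun f : Fin (2 * p) → V => ∀ j, ∃ k, k ≠ j ∧ r (f j) (f k)).card
      ≤ (4 * Fintype.card V * p * b) ^ p := by
  classical
  have h1 : (Finset.univ.filter fun f : Fin (2 * p) → V => ∀ j, ∃ k, k ≠ j ∧ r (f j) (f k)) ⊆
      (Finset.powersetCard p (Finset.univ : Finset (Fin (2 * p)))).biUnion fun D =>
        Finset.univ.filter fun f : Fin (2 * p) → V => ∀ j, j ∉ D → ∃ k ∈ D, r (f k) (f j) := by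
    intro f hf
    simp only [Finset.mem_filter, Finset.mem_univ, true_and] at hf
    obtain ⟨D, hD, hd⟩ := exists_dominating_card_eq (fun i j => r (f i) (f j))
      (fun i j => hs _ _) hf
    simp only [Finset.mem_biUnion, Finset.mem_powersetCard, Finset.mem_filter, Finset.mem_univ,
      true_and]
    refine ⟨D, ⟨Finset.subset_univ _, hD⟩, fun j hj => ?_⟩
    obtain ⟨k, hk, hr⟩ := hd j hj
    exact ⟨k, hk, hs _ _ hr⟩
  refine (Finset.card_le_card h1).trans ?_
  refine (Finset.card_biUnion_le_card_mul _ _ (Fintype.card V ^ p * (p * b) ^ p) ?_).trans ?_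
  · intro D hD
    have hD := (Finset.mem_powersetCard.1 hD).2
    refine le_trans (le_of_eq (by congr!)) ((card_dominated_le r hb D).trans (le_of_eq ?_))
    rw [hD, Fintype.card_fin]
    congr 2
    omega
  · rw [Finset.card_powersetCard, Finset.card_univ, Fintype.card_fin]
    -- Bounds the number of possible dominating sets.
    have h4 : (2 * p).choose p ≤ 4 ^ p := by
      have := Nat.choose_le_two_pow (2 * p) p
      rwa [pow_mul] at this
    calc _ ≤ 4 ^ p * (Fintype.card V ^ p * (p * b) ^ p) := Nat.mul_le_mul_right _ h4
      _ = _ := by rw [← mul_pow, ← mul_pow]; ring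

/-- Expansion of a power of a sum in a noncommutative ring. -/
theorem sum_pow_eq_sum_list_prod {R V : Type*} [Ring R] [Fintype V] (Y : V → R) (N : ℕ) :
    (∑ i, Y i) ^ N = ∑ f : Fin N → V, (List.ofFn fun k => Y (f k)).prod := by
  induction N with
  | zero => simp
  | succ N ih =>
    rw [pow_succ', ih, Finset.sum_mul_sum, ← (Fin.consEquiv fun _ => V).sum_comp,
      Fintype.sum_prod_type]
    refine Finset.sum_congr rfl fun i _ => Finset.sum_congr rfl fun f _ => ?_
    simp [List.ofFn_succ, Fin.consEquiv]

/-! ### Trace inequalities and functions of an eigenvector -/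

section Trace

variable {n : Type*} [Fintype n] [DecidableEq n]

theorem toEuclideanLin_mul_apply (A B : Matrix n n ℂ) (v : EuclideanSpace ℂ n) :
    Matrix.toEuclideanLin (A * B) v = Matrix.toEuclideanLin A (Matrix.toEuclideanLin B v) := by
  simp [Matrix.toLpLin_apply, Matrix.mulVec_mulVec]

theorem toEuclideanLin_one_apply (v : EuclideanSpace ℂ n) :
    Matrix.toEuclideanLin (1 : Matrix n n ℂ) v = v := by
  simp

theorem inner_toEuclideanLin_right (A : Matrix n n ℂ) (u v : EuclideanSpace ℂ n) :
    inner ℂ u (Matrix.toEuclideanLin A v) = inner ℂ (Matrix.toEuclideanLin A.conjTranspose u) v := by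
  rw [Matrix.toEuclideanLin_conjTranspose_eq_adjoint, LinearMap.adjoint_inner_left]

theorem norm_toEuclideanLin_le (A : Matrix n n ℂ) (v : EuclideanSpace ℂ n) :
    ‖Matrix.toEuclideanLin A v‖ ≤ ‖A‖ * ‖v‖ := by
  rw [Matrix.toLpLin_apply]
  exact Matrix.l2_opNorm_mulVec A v

/-- Bessel's inequality for the Hilbert-Schmidt norm. -/
theorem sum_norm_sq_toEuclideanLin_le {κ : Type*} [Fintype κ] {v : κ → EuclideanSpace ℂ n}
    (hv : Orthonormal ℂ v) (M : Matrix n n ℂ) :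
    ∑ k, ‖Matrix.toEuclideanLin M (v k)‖ ^ 2 ≤ (Matrix.trace (M.conjTranspose * M)).re := by
  -- The entries of `M (v k)` are, up to conjugation, inner products of `v k` with the conjugated
  -- rows of `M`, so Bessel applies row by row.
  have h1 : ∀ k, ‖Matrix.toEuclideanLin M (v k)‖ ^ 2
      = ∑ i, ‖inner ℂ (v k) (WithLp.toLp 2 (star (M i)) : EuclideanSpace ℂ n)‖ ^ 2 := by
    intro k
    rw [EuclideanSpace.norm_sq_eq]
    refine Finset.sum_congr rfl fun i _ => ?_
    rw [norm_inner_symm]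
    simp [Matrix.toLpLin_apply, Matrix.mulVec, PiLp.inner_apply, dotProduct, mul_comm]
  simp_rw [h1]
  rw [Finset.sum_comm]
  have h2 : (Matrix.trace (M.conjTranspose * M)).re
      = ∑ i, ‖(WithLp.toLp 2 (star (M i)) : EuclideanSpace ℂ n)‖ ^ 2 := by
    simp only [EuclideanSpace.norm_sq_eq, Matrix.trace, Matrix.diag, Matrix.mul_apply,
      Complex.re_sum, Pi.star_apply, norm_star, Matrix.conjTranspose_apply]
    rw [Finset.sum_comm]
    refine Finset.sum_congr rfl fun i _ => Finset.sum_congr rfl fun j _ => ?_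
    rw [RCLike.star_def, ← Complex.normSq_eq_conj_mul_self, Complex.ofReal_re,
      Complex.normSq_eq_norm_sq]
  rw [h2]
  exact Finset.sum_le_sum fun i _ => hv.sum_inner_products_le _

/-- With a Hermitian square root `S`, the trace is the sum of `⟨S e_i, A S e_i⟩` over an orthonormal
basis; each term is at most `‖A‖ ‖S e_i‖ ^ 2`. -/
theorem norm_trace_mul_le {S : Matrix n n ℂ} (hS : S.IsHermitian) (A : Matrix n n ℂ) :
    ‖Matrix.trace (S * S * A)‖ ≤ ‖A‖ * (Matrix.trace (S * S)).re := by
  set e : n → EuclideanSpace ℂ n := fun i => EuclideanSpace.basisFun n ℂ i with he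
  have h1 : Matrix.trace (S * S * A) = ∑ i, inner ℂ (Matrix.toEuclideanLin S (e i))
      (Matrix.toEuclideanLin A (Matrix.toEuclideanLin S (e i))) := by
    rw [mul_assoc, Matrix.trace_mul_comm, Matrix.trace]
    refine Finset.sum_congr rfl fun i _ => ?_
    have h := inner_toEuclideanLin_right S (e i)
      (Matrix.toEuclideanLin A (Matrix.toEuclideanLin S (e i)))
    rw [hS.eq] at h
    rw [← h, ← toEuclideanLin_mul_apply, ← toEuclideanLin_mul_apply]
    simp only [he, EuclideanSpace.basisFun_apply, PiLp.inner_apply, Matrix.toLpLin_apply,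
      PiLp.ofLp_single, Matrix.mulVec_single_one, Matrix.diag_apply, mul_assoc]
    simp [Pi.single_apply, apply_ite]
  have h2 := sum_norm_sq_toEuclideanLin_le (EuclideanSpace.basisFun n ℂ).orthonormal S
  rw [hS.eq] at h2
  rw [h1]
  calc _ ≤ ∑ i, ‖A‖ * ‖Matrix.toEuclideanLin S (e i)‖ ^ 2 := by
        refine norm_sum_le_of_le _ fun i _ => (norm_inner_le_norm _ _).trans ?_
        calc _ ≤ ‖Matrix.toEuclideanLin S (e i)‖ * (‖A‖ * ‖Matrix.toEuclideanLin S (e i)‖) := by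
              gcongr
              exact norm_toEuclideanLin_le _ _
          _ = _ := by ring
    _ ≤ _ := by
        rw [← Finset.mul_sum]
        gcongr

theorem exp_smul_toEuclideanLin_apply {H : Matrix n n ℂ} {E : ℂ} {ψ : EuclideanSpace ℂ n}
    (h : Matrix.toEuclideanLin H ψ = E • ψ) (c : ℂ) :
    Matrix.toEuclideanLin (NormedSpace.exp (c • H)) ψ = Complex.exp (c * E) • ψ := by
  have hpow : ∀ k : ℕ, Matrix.toEuclideanLin ((c • H) ^ k) ψ = (c * E) ^ k • ψ := by
    intro k
    induction k with
    | zero => simp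
    | succ k ih =>
      rw [pow_succ, toEuclideanLin_mul_apply, map_smul, LinearMap.smul_apply, h, smul_smul,
        map_smul, ih, smul_smul, pow_succ']
  let L : Matrix n n ℂ →ₗ[ℂ] EuclideanSpace ℂ n :=
    { toFun := fun A => Matrix.toEuclideanLin A ψ
      map_add' := fun A B => by simp
      map_smul' := fun a A => by simp }
  have h1 := (NormedSpace.exp_series_hasSum_exp' (𝕂 := ℂ) (c • H)).mapL (LinearMap.toContinuousLinearMap L)
  have h2 := (NormedSpace.exp_series_hasSum_exp' (𝕂 := ℂ) (c * E)).smul_const ψ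
  rw [Complex.exp_eq_exp_ℂ]
  refine h1.unique ?_
  convert h2 using 2 with k
  change Matrix.toEuclideanLin _ ψ = _
  rw [map_smul, LinearMap.smul_apply, hpow, smul_smul, smul_eq_mul]

/-- Iterated Cauchy–Schwarz: `‖Y ψ‖ ^ 2 = ⟨ψ, Y ^ 2 ψ⟩` lets each step replace `Y` by `Y ^ 2`. This
is why later moments have exponent twice a power of two. -/
theorem norm_inner_pow_le {Y : Matrix n n ℂ} (hY : Y.IsHermitian) {ψ : EuclideanSpace ℂ n}
    (hψ : ‖ψ‖ = 1) (k : ℕ) :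
    ‖inner ℂ ψ (Matrix.toEuclideanLin Y ψ)‖ ^ (2 * 2 ^ k)
      ≤ ‖Matrix.toEuclideanLin (Y ^ 2 ^ k) ψ‖ ^ 2 := by
  have h0 : ∀ Y : Matrix n n ℂ, ‖inner ℂ ψ (Matrix.toEuclideanLin Y ψ)‖ ^ 2
      ≤ ‖Matrix.toEuclideanLin Y ψ‖ ^ 2 := by
    intro Y
    gcongr
    simpa [hψ] using norm_inner_le_norm (𝕜 := ℂ) ψ (Matrix.toEuclideanLin Y ψ)
  induction k generalizing Y with
  | zero => simpa using h0 Y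
  | succ k ih =>
    have h1 : ‖Matrix.toEuclideanLin Y ψ‖ ^ 2
        = ‖inner ℂ ψ (Matrix.toEuclideanLin (Y ^ 2) ψ)‖ := by
      rw [pow_two Y, toEuclideanLin_mul_apply, inner_toEuclideanLin_right, hY.eq,
        inner_self_eq_norm_sq_to_K]
      simp
    have h2 := ih (hY.pow 2)
    rw [← pow_mul, ← pow_succ'] at h2
    refine le_trans ?_ h2
    rw [pow_succ' 2 k, pow_mul]
    gcongr
    exact (h0 Y).trans h1.le

end Trace

/-! ### The canonical state -/

section Gibbs

variable {d : ℕ} {m : Fin d → ℕ} {Λ : Finset (Site m)} {q : ℕ} {H : Operator Λ q}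

theorem isHermitian_exp_half_smul (hH : H.IsHermitian) (β : ℝ) :
    (NormedSpace.exp (-((β / 2 : ℝ) : ℂ) • H)).IsHermitian := by
  refine Matrix.IsHermitian.exp ?_
  unfold Matrix.IsHermitian
  rw [Matrix.conjTranspose_smul, hH.eq]
  simp

/-- Supplies an explicit Hermitian square root of the Boltzmann weight, through which its positivity
is used. -/
theorem exp_eq_exp_half_mul_self (H : Operator Λ q) (β : ℝ) :
    NormedSpace.exp (-(β : ℂ) • H)
      = NormedSpace.exp (-((β / 2 : ℝ) : ℂ) • H) * NormedSpace.exp (-((β / 2 : ℝ) : ℂ) • H) := by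
  have h := Matrix.exp_add_of_commute _ _ (Commute.refl (-((β / 2 : ℝ) : ℂ) • H))
  refine Eq.trans ?_ h
  rw [← add_smul]
  congr 2
  push_cast
  ring

theorem trace_exp_eq_partitionFunction (hH : H.IsHermitian) (β : ℝ) :
    Matrix.trace (NormedSpace.exp (-(β : ℂ) • H)) = partitionFunction H β := by
  have h : (NormedSpace.exp (-(β : ℂ) • H)).IsHermitian := by
    have := isHermitian_exp_half_smul hH (2 * β)
    rwa [mul_div_cancel_left₀ _ two_ne_zero] at this
  have h2 := Matrix.trace_conjTranspose (NormedSpace.exp (-(β : ℂ) • H))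
  rw [h.eq] at h2
  exact (Complex.conj_eq_iff_re.1 h2.symm).symm

theorem exp_half_smul_toEuclideanLin_apply {E : ℝ} {ψ : State Λ q} (h : IsEigenstate H E ψ) (β : ℝ) :
    Matrix.toEuclideanLin (NormedSpace.exp (-((β / 2 : ℝ) : ℂ) • H)) ψ
      = ((Real.exp (-(β * E) / 2) : ℝ) : ℂ) • ψ := by
  rw [exp_smul_toEuclideanLin_apply h.2]
  congr 1
  push_cast
  congr 1
  ring

/-- Any orthonormal family of eigenvectors bounds the partition function from below. -/
theorem sum_exp_le_partitionFunction (hH : H.IsHermitian) (β : ℝ) {κ : Type*} [Fintype κ]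
    {v : κ → State Λ q} (hv : Orthonormal ℂ v) {E : κ → ℝ} (h : ∀ k, IsEigenstate H (E k) (v k)) :
    ∑ k, Real.exp (-(β * E k)) ≤ partitionFunction H β := by
  have h1 := sum_norm_sq_toEuclideanLin_le hv (NormedSpace.exp (-((β / 2 : ℝ) : ℂ) • H))
  rw [(isHermitian_exp_half_smul hH β).eq, ← exp_eq_exp_half_mul_self] at h1
  refine le_trans (le_of_eq (Finset.sum_congr rfl fun k _ => ?_)) h1
  rw [exp_half_smul_toEuclideanLin_apply (h k), norm_smul, (h k).1, mul_one, Complex.norm_real,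
    Real.norm_of_nonneg (Real.exp_pos _).le, ← Real.exp_nat_mul]
  congr 1
  push_cast
  ring

theorem exp_le_partitionFunction (hH : H.IsHermitian) (β : ℝ) {E : ℝ} {ψ : State Λ q}
    (h : IsEigenstate H E ψ) : Real.exp (-(β * E)) ≤ partitionFunction H β := by
  have hv : Orthonormal ℂ fun _ : Unit => ψ := by
    refine ⟨fun _ => h.1, fun i j hij => (hij (Subsingleton.elim _ _)).elim⟩
  simpa using sum_exp_le_partitionFunction hH β hv (E := fun _ => E) fun _ => h

theorem norm_trace_canonicalState_mul_le (hH : H.IsHermitian) {β : ℝ}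
    (hZ : 0 < partitionFunction H β) (A : Operator Λ q) :
    ‖Matrix.trace (canonicalState H β * A)‖ ≤ ‖A‖ := by
  have h1 := norm_trace_mul_le (isHermitian_exp_half_smul hH β) A
  rw [← exp_eq_exp_half_mul_self] at h1
  change _ ≤ ‖A‖ * partitionFunction H β at h1
  rw [canonicalState, smul_mul_assoc, Matrix.trace_smul, norm_smul, norm_inv, Complex.norm_real,
    Real.norm_of_nonneg hZ.le, inv_mul_le_iff₀ hZ, mul_comm]
  exact h1

theorem trace_canonicalState (hH : H.IsHermitian) {β : ℝ} (hZ : 0 < partitionFunction H β) :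
    Matrix.trace (canonicalState H β) = 1 := by
  rw [canonicalState, Matrix.trace_smul, trace_exp_eq_partitionFunction hH, smul_eq_mul]
  exact inv_mul_cancel₀ (by exact_mod_cast hZ.ne')

/-- Moments in an eigenstate are bounded by moments in the canonical state. -/
theorem norm_expectation_pow_le (hH : H.IsHermitian) {β : ℝ} {E : ℝ} {ψ : State Λ q}
    (h : IsEigenstate H E ψ) {Y : Operator Λ q} (hY : Y.IsHermitian) (k : ℕ) :
    ‖expectation ψ Y‖ ^ (2 * 2 ^ k) ≤ Real.exp (β * E) * partitionFunction H β *
      ‖Matrix.trace (canonicalState H β * Y ^ (2 * 2 ^ k))‖ := by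
  have hZ : 0 < partitionFunction H β := (Real.exp_pos _).trans_le (exp_le_partitionFunction hH β h)
  set S := NormedSpace.exp (-((β / 2 : ℝ) : ℂ) • H) with hS
  set X := Y ^ 2 ^ k with hX
  have hXh : X.IsHermitian := hY.pow _
  have hSh : S.IsHermitian := isHermitian_exp_half_smul hH β
  have hv : Orthonormal ℂ fun _ : Unit => ψ := by
    refine ⟨fun _ => h.1, fun i j hij => (hij (Subsingleton.elim _ _)).elim⟩
  -- Keep only `ψ` in the Hilbert–Schmidt norm of `X S`: the left side becomes `e^{-βE} ‖X ψ‖ ^ 2`,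
  -- the right side `tr (e^{-βH} X ^ 2)`.
  have h1 := sum_norm_sq_toEuclideanLin_le hv (X * S)
  rw [Matrix.conjTranspose_mul, hXh.eq, hSh.eq, mul_assoc S X, Matrix.trace_mul_comm,
    mul_assoc, mul_assoc, ← exp_eq_exp_half_mul_self, ← mul_assoc, Matrix.trace_mul_comm] at h1
  simp only [Finset.univ_unique, Finset.sum_const, Finset.card_singleton, one_smul] at h1
  rw [toEuclideanLin_mul_apply, exp_half_smul_toEuclideanLin_apply h, map_smul, norm_smul, Complex.norm_real,
    Real.norm_of_nonneg (Real.exp_pos _).le, mul_pow, ← Real.exp_nat_mul] at h1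
  have h2 : X * X = Y ^ (2 * 2 ^ k) := by rw [hX, ← pow_add, two_mul]
  rw [h2] at h1
  have h3 : ‖expectation ψ Y‖ ^ (2 * 2 ^ k) ≤ ‖Matrix.toEuclideanLin X ψ‖ ^ 2 :=
    norm_inner_pow_le hY h.1 k
  have h4 : partitionFunction H β * ‖Matrix.trace (canonicalState H β * Y ^ (2 * 2 ^ k))‖
      = ‖Matrix.trace (NormedSpace.exp (-(β : ℂ) • H) * Y ^ (2 * 2 ^ k))‖ := by
    rw [canonicalState, smul_mul_assoc, Matrix.trace_smul, norm_smul, norm_inv, Complex.norm_real,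
      Real.norm_of_nonneg hZ.le, mul_inv_cancel_left₀ hZ.ne']
  rw [mul_assoc, h4]
  have h5 : ((2 : ℕ) : ℝ) * (-(β * E) / 2) = -(β * E) := by
    push_cast
    ring
  rw [h5, Real.exp_neg, inv_mul_le_iff₀ (Real.exp_pos _)] at h1
  refine h3.trans (h1.trans ?_)
  gcongr
  exact Complex.re_le_norm _

end Gibbs

/-! ### Isolation scale and summation constants -/

/-- Scale at which an index of a tuple becomes isolated. -/
theorem exists_isolation_gap {V : Type*} (D : V → V → ℕ) (a : ℕ) {N : ℕ} (hN : 2 ≤ N)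
    (f : Fin N → V) :
    ∃ L : ℕ, (∀ j, ∃ k, k ≠ j ∧ D (f j) (f k) ≤ a + L) ∧
      (0 < L → ∃ j, ∀ k, k ≠ j → a + L ≤ D (f j) (f k)) := by
  classical
  have hex : ∃ L : ℕ, ∀ j, ∃ k, k ≠ j ∧ D (f j) (f k) ≤ a + L := by
    refine ⟨∑ j, ∑ k, D (f j) (f k), fun j => ?_⟩
    have : Nontrivial (Fin N) := Fin.nontrivial_iff_two_le.2 hN
    obtain ⟨k, hk⟩ := exists_ne j
    refine ⟨k, hk, ?_⟩
    have h1 : D (f j) (f k) ≤ ∑ k, D (f j) (f k) :=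
      Finset.single_le_sum (f := fun k => D (f j) (f k)) (fun _ _ => Nat.zero_le _)
        (Finset.mem_univ k)
    have h2 : ∑ k, D (f j) (f k) ≤ ∑ j, ∑ k, D (f j) (f k) :=
      Finset.single_le_sum (f := fun j => ∑ k, D (f j) (f k)) (fun _ _ => Nat.zero_le _)
        (Finset.mem_univ j)
    omega
  refine ⟨Nat.find hex, Nat.find_spec hex, fun hpos => ?_⟩
  -- Failure at `L - 1` gives an index whose distances all exceed `a + L - 1`, hence are at least `a
  -- + L`.
  have hmin := Nat.find_min hex (Nat.sub_lt hpos one_pos)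
  push Not at hmin
  obtain ⟨j, hj⟩ := hmin
  refine ⟨j, fun k hk => ?_⟩
  have := hj k hk
  omega

/-- Half of the decay pays for the polynomial growth in `L`; the other half remains as a geometric
sequence. -/
theorem pow_mul_exp_neg_le {ξ : ℝ} (hξ : 0 < ξ) {d p : ℕ} (hd : 1 ≤ d) (hp : 1 ≤ p) {ℓ T : ℕ}
    (hℓ : ℓ ≤ T) (hpT : p ≤ T) (L : ℕ) :
    (2 * (2 * ℓ + L) + 1 : ℝ) ^ (d * p) * Real.exp (-L / ξ)
      ≤ ((5 + 4 * ξ * d) * T) ^ (d * p) * Real.exp (-1 / (2 * ξ)) ^ L := by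
  have hd0 : (1 : ℝ) ≤ d := by exact_mod_cast hd
  have hp0 : (1 : ℝ) ≤ p := by exact_mod_cast hp
  have hℓ0 : (ℓ : ℝ) ≤ T := by exact_mod_cast hℓ
  have hpT0 : (p : ℝ) ≤ T := by exact_mod_cast hpT
  -- Chosen so that `(e^{L/s}) ^ (d p) = e^{L/(2ξ)}`.
  set s : ℝ := 2 * ξ * d * p with hs
  have hspos : 0 < s := by positivity
  have h1 : (L : ℝ) ≤ s * Real.exp (L / s) := by
    have := Real.add_one_le_exp ((L : ℝ) / s)
    calc (L : ℝ) = s * (L / s) := by field_simp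
      _ ≤ _ := by gcongr; linarith
  have h2 : (1 : ℝ) ≤ Real.exp (L / s) := Real.one_le_exp (by positivity)
  have h3 : (2 * (2 * ℓ + L) + 1 : ℝ) ≤ (5 + 4 * ξ * d) * T * Real.exp (L / s) := by
    calc (2 * (2 * ℓ + L) + 1 : ℝ) ≤ 5 * T * 1 + 2 * L := by linarith
      _ ≤ 5 * T * Real.exp (L / s) + 2 * (s * Real.exp (L / s)) := by gcongr
      _ = (5 * T + 4 * ξ * d * p) * Real.exp (L / s) := by rw [hs]; ring
      _ ≤ (5 * T + 4 * ξ * d * T) * Real.exp (L / s) := by gcongr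
      _ = _ := by ring
  calc _ ≤ ((5 + 4 * ξ * d) * T * Real.exp (L / s)) ^ (d * p) * Real.exp (-L / ξ) := by gcongr
    _ = ((5 + 4 * ξ * d) * T) ^ (d * p) * (Real.exp (L / s) ^ (d * p) * Real.exp (-L / ξ)) := by
        rw [mul_pow]; ring
    _ = _ := by
        congr 1
        rw [← Real.exp_nat_mul, ← Real.exp_add, ← Real.exp_nat_mul]
        congr 1
        rw [hs]
        push_cast
        field_simp
        ring

/-- The constant in the moment bound for clustering states. -/
noncomputable def momentConstant (d : ℕ) (r ξ : ℝ) : ℝ :=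
  16 * (Real.exp (max r 0 / ξ) * (1 - Real.exp (-1 / (2 * ξ)))⁻¹) * (5 + 4 * ξ * d) ^ d

theorem one_le_inv_one_sub_exp {ξ : ℝ} (hξ : 0 < ξ) :
    1 ≤ (1 - Real.exp (-1 / (2 * ξ)))⁻¹ := by
  have h1 : Real.exp (-1 / (2 * ξ)) < 1 := by
    rw [Real.exp_lt_one_iff]
    exact div_neg_of_neg_of_pos (by norm_num) (by positivity)
  rw [one_le_inv₀ (by linarith)]
  linarith [Real.exp_pos (-1 / (2 * ξ))]

theorem one_le_momentConstant (d : ℕ) (r : ℝ) {ξ : ℝ} (hξ : 0 < ξ) :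
    1 ≤ momentConstant d r ξ := by
  have h1 := one_le_inv_one_sub_exp hξ
  have h2 : 1 ≤ Real.exp (max r 0 / ξ) := Real.one_le_exp (by positivity)
  have h3 : 1 ≤ (5 + 4 * ξ * (d : ℝ)) ^ d := by
    refine one_le_pow₀ ?_
    have : 0 ≤ 4 * ξ * (d : ℝ) := by positivity
    linarith
  unfold momentConstant
  refine one_le_mul_of_one_le_of_one_le ?_ h3
  linarith [one_le_mul_of_one_le_of_one_le h2 h1]

/-! ### Moments in a clustering state -/

section Moments

variable {d : ℕ} {m : Fin d → ℕ} {Λ : Finset (Site m)} {q : ℕ}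

theorem norm_one_le (hq : 0 < q) : ‖(1 : Operator Λ q)‖ ≤ 1 := by
  have : Nonempty (Fin q) := ⟨⟨0, hq⟩⟩
  exact (CStarRing.norm_one).le

theorem norm_list_prod_le (hq : 0 < q) (l : List (Operator Λ q)) {c : ℝ} (hc : 0 ≤ c)
    (h : ∀ A ∈ l, ‖A‖ ≤ c) : ‖l.prod‖ ≤ c ^ l.length := by
  induction l with
  | nil => simpa using norm_one_le hq
  | cons A l ih =>
    rw [List.prod_cons, List.length_cons, pow_succ']
    refine (norm_mul_le _ _).trans ?_
    gcongr
    · exact h A (by simp)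
    · exact ih fun B hB => h B (by simp [hB])

variable {r ξ : ℝ} {ρ : Operator Λ q} {ℓ : ℕ} {Y : Λ → Operator Λ q}

/-- Clustering bounds the expectation of a product having an isolated centered factor. -/
theorem IsClustering.norm_trace_list_prod_le (hq : 0 < q) (hρ : IsClustering r ξ ρ) (hξ : 0 < ξ)
    (hYs : ∀ i, SupportedOn (ball i ℓ) (Y i)) (hYn : ∀ i, ‖Y i‖ ≤ 2)
    (hY0 : ∀ i, Matrix.trace (ρ * Y i) = 0) {N : ℕ} (hN : 2 ≤ N) (f : Fin N → Λ) {L : ℕ}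
    (hL : 0 < L) (hrL : r ≤ L) (j : Fin N)
    (hj : ∀ k, k ≠ j → 2 * ℓ + L ≤ manhattan (f j : Site m) (f k : Site m)) :
    ‖Matrix.trace (ρ * (List.ofFn fun k => Y (f k)).prod)‖ ≤ 2 ^ N * Real.exp (-L / ξ) := by
  set l := List.ofFn fun k => Y (f k) with hl
  have hlen : l.length = N := by simp [hl]
  set W : Set Λ := {x | ∃ k, k ≠ j ∧ x ∈ ball (f k) ℓ} with hW
  have hmem1 : ∀ A ∈ l.take j, ∃ k, k ≠ j ∧ A = Y (f k) := by
    intro A hA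
    obtain ⟨k, hk, rfl⟩ := List.mem_take_iff_getElem.1 hA
    have hkN : k < N := by omega
    refine ⟨⟨k, hkN⟩, fun he => ?_, by simp [hl]⟩
    have : k = j := congrArg Fin.val he
    omega
  have hmem2 : ∀ A ∈ l.drop (j + 1), ∃ k, k ≠ j ∧ A = Y (f k) := by
    intro A hA
    obtain ⟨k, hk, rfl⟩ := List.mem_drop_iff_getElem.1 hA
    have hkN : j + 1 + k < N := by omega
    refine ⟨⟨j + 1 + k, by omega⟩, fun he => ?_, by simp [hl]⟩
    have : (j : ℕ) + 1 + k = j := congrArg Fin.val he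
    omega
  have hsupp : ∀ l' : List (Operator Λ q), (∀ A ∈ l', ∃ k, k ≠ j ∧ A = Y (f k)) →
      SupportedOn W l'.prod := by
    intro l' h'
    refine SupportedOn.list_prod hq l' fun A hA => ?_
    obtain ⟨k, hk, rfl⟩ := h' A hA
    have hsub : ball (f k) ℓ ⊆ W := by
      intro x hx
      exact ⟨k, hk, hx⟩
    exact (hYs (f k)).mono hq hsub
  have hdist : ∀ x ∈ ball (f j) ℓ, ∀ y ∈ W, L ≤ manhattan (x : Site m) (y : Site m) := by
    rintro x hx y ⟨k, hk, hy⟩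
    have hx : manhattan (f j : Site m) (x : Site m) ≤ ℓ := hx
    have hy : manhattan (f k : Site m) (y : Site m) ≤ ℓ := hy
    have h1 := hj k hk
    have h2 := manhattan_triangle (f j : Site m) x (f k)
    have h3 := manhattan_triangle (x : Site m) y (f k)
    rw [manhattan_comm (y : Site m) (f k)] at h3
    omega
  have hdisj : Disjoint W (ball (f j) ℓ) := by
    rw [Set.disjoint_left]
    intro x hxW hx
    have := hdist x hx x hxW
    rw [manhattan_self] at this
    omega
  have hself : ∀ i : Λ, i ∈ ball i ℓ := by
    intro i
    change manhattan (i : Site m) i ≤ ℓ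
    rw [manhattan_self]
    exact Nat.zero_le _
  have hWne : W.Nonempty := by
    have : Nontrivial (Fin N) := Fin.nontrivial_iff_two_le.2 hN
    obtain ⟨k, hk⟩ := exists_ne j
    exact ⟨f k, k, hk, hself _⟩
  -- Since its support is disjoint from the others, the isolated factor can be moved to the front,
  -- giving a product of two distant operators.
  have hprod : l.prod = Y (f j) * ((l.take j).prod * (l.drop (j + 1)).prod) := by
    have hjl : (j : ℕ) < l.length := by omega
    have hcomm := (hsupp _ hmem1).commute hq hdisj (hYs (f j))
    conv_lhs => rw [← List.take_append_drop j l, List.drop_eq_getElem_cons hjl]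
    rw [List.prod_append, List.prod_cons, ← mul_assoc, ← mul_assoc]
    congr 1
    have : l[(j : ℕ)] = Y (f j) := by simp [hl]
    rw [this]
    exact hcomm.eq
  have hLd : (L : ℝ) ≤ setDist (ball (f j) ℓ) W := by
    exact_mod_cast le_setDist ⟨f j, hself _⟩ hWne hdist
  have hcl := hρ (ball (f j) ℓ) W ⟨f j, hself _⟩ hWne (hrL.trans hLd) (Y (f j)) _ (hYs (f j))
    ((hsupp _ hmem1).mul hq (hsupp _ hmem2))
  -- Centering removes the product of expectations.
  rw [hY0, zero_mul, sub_zero, ← hprod] at hcl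
  refine hcl.trans ?_
  have hB : ‖(l.take j).prod * (l.drop (j + 1)).prod‖ ≤ 2 ^ (N - 1) := by
    have hn : ∀ l' : List (Operator Λ q), (∀ A ∈ l', ∃ k, k ≠ j ∧ A = Y (f k)) →
        ‖l'.prod‖ ≤ 2 ^ l'.length := by
      intro l' h'
      refine norm_list_prod_le hq l' zero_le_two fun A hA => ?_
      obtain ⟨k, _, rfl⟩ := h' A hA
      exact hYn _
    calc _ ≤ ‖(l.take j).prod‖ * ‖(l.drop (j + 1)).prod‖ := norm_mul_le _ _
      _ ≤ 2 ^ (l.take j).length * 2 ^ (l.drop (j + 1)).length := by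
          gcongr
          · exact hn _ hmem1
          · exact hn _ hmem2
      _ = 2 ^ (N - 1) := by
          rw [← pow_add, List.length_take, List.length_drop, hlen]
          congr 1
          have := j.2
          omega
  have h2N : (2 : ℝ) ^ N = 2 * 2 ^ (N - 1) := by
    rw [← pow_succ']
    congr 1
    omega
  rw [h2N]
  gcongr
  exact hYn _

/-- Moment bound for sums of centered local operators in a clustering state. -/
theorem IsClustering.norm_trace_sum_pow_le (hd : 1 ≤ d) (hq : 0 < q) (hρ : IsClustering r ξ ρ)
    (hξ : 0 < ξ) (hρn : ∀ A, ‖Matrix.trace (ρ * A)‖ ≤ ‖A‖)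
    (hYs : ∀ i, SupportedOn (ball i ℓ) (Y i)) (hYn : ∀ i, ‖Y i‖ ≤ 2)
    (hY0 : ∀ i, Matrix.trace (ρ * Y i) = 0) {p : ℕ} (hp : 1 ≤ p) :
    ‖Matrix.trace (ρ * (∑ i, Y i) ^ (2 * p))‖
      ≤ (momentConstant d r ξ * (Λ.card * (p * (max ℓ p : ℕ) ^ d))) ^ p := by
  classical
  choose g hg1 hg2 using fun f : Fin (2 * p) → Λ =>
    exists_isolation_gap (fun x y : Λ => manhattan (x : Site m) (y : Site m)) (2 * ℓ)
      (by omega : 2 ≤ 2 * p) f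
  set K : ℝ := Real.exp (max r 0 / ξ) with hK
  have hK1 : 1 ≤ K := Real.one_le_exp (by positivity)
  set A : ℝ := (1 - Real.exp (-1 / (2 * ξ)))⁻¹ with hA
  have hA1 : 1 ≤ A := one_le_inv_one_sub_exp hξ
  have hterm : ∀ f : Fin (2 * p) → Λ, ‖Matrix.trace (ρ * (List.ofFn fun k => Y (f k)).prod)‖
      ≤ 4 ^ p * (K * Real.exp (-(g f : ℝ) / ξ)) := by
    intro f
    have h4 : (4 : ℝ) ^ p = 2 ^ (2 * p) := by rw [pow_mul]; norm_num
    by_cases hc : 0 < g f ∧ r ≤ g f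
    · obtain ⟨j, hj⟩ := hg2 f hc.1
      refine (hρ.norm_trace_list_prod_le hq hξ hYs hYn hY0 (by omega) f hc.1 hc.2 j hj).trans ?_
      rw [h4]
      gcongr
      exact le_mul_of_one_le_left (Real.exp_pos _).le hK1
    -- Here clustering is unavailable, but the gap is at most `max r 0`, so `K e^{-g/ξ} ≥ 1` and the
    -- norm bound suffices.
    · have h1 : ‖Matrix.trace (ρ * (List.ofFn fun k => Y (f k)).prod)‖ ≤ 2 ^ (2 * p) := by
        refine (hρn _).trans ((norm_list_prod_le hq _ zero_le_two ?_).trans (by simp))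
        intro B hB
        obtain ⟨k, rfl⟩ := (List.mem_ofFn' _ _).1 hB
        exact hYn _
      have h2 : (g f : ℝ) ≤ max r 0 := by
        rcases Nat.eq_zero_or_pos (g f) with h0 | h0
        · rw [h0]
          simp
        · exact (not_le.1 fun hr => hc ⟨h0, hr⟩).le.trans (le_max_left _ _)
      rw [h4]
      refine h1.trans (le_mul_of_one_le_right (by positivity) ?_)
      rw [hK, ← Real.exp_add, ← add_div]
      refine Real.one_le_exp (div_nonneg ?_ hξ.le)
      linarith
  have hcount : ∀ L : ℕ, ((Finset.univ.filter fun f => g f = L).card : ℝ)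
      ≤ (4 * Λ.card * p) ^ p * (2 * (2 * ℓ + L) + 1) ^ (d * p) := by
    intro L
    have h1 := card_clustered_le
      (fun x y : Λ => manhattan (x : Site m) (y : Site m) ≤ 2 * ℓ + L)
      (fun x y h => by rwa [manhattan_comm]) (fun v => card_ball_le Λ v (2 * ℓ + L)) p
    have h2 : (Finset.univ.filter fun f => g f = L).card
        ≤ (4 * Fintype.card Λ * p * (2 * (2 * ℓ + L) + 1) ^ d) ^ p := by
      refine (Finset.card_le_card ?_).trans h1
      intro f hf
      have hf : g f = L := by simpa using hf
      simp only [Finset.mem_filter, Finset.mem_univ, true_and]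
      have := hg1 f
      rwa [hf] at this
    calc ((Finset.univ.filter fun f => g f = L).card : ℝ)
        ≤ (((4 * Fintype.card Λ * p * (2 * (2 * ℓ + L) + 1) ^ d) ^ p : ℕ) : ℝ) := by
          exact_mod_cast h2
      _ = _ := by
          rw [Fintype.card_coe, pow_mul, ← mul_pow]
          push_cast
          rfl
  rw [sum_pow_eq_sum_list_prod, Finset.mul_sum, Matrix.trace_sum]
  set T : ℕ := max ℓ p with hT
  calc ‖∑ f : Fin (2 * p) → Λ, Matrix.trace (ρ * (List.ofFn fun k => Y (f k)).prod)‖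
      ≤ ∑ f : Fin (2 * p) → Λ, 4 ^ p * (K * Real.exp (-(g f : ℝ) / ξ)) :=
        norm_sum_le_of_le _ fun f _ => hterm f
    _ = ∑ L ∈ Finset.univ.image g, ∑ f with g f = L, 4 ^ p * (K * Real.exp (-(g f : ℝ) / ξ)) :=
        (Finset.sum_fiberwise_of_maps_to (fun f _ => Finset.mem_image_of_mem g
          (Finset.mem_univ f)) _).symm
    _ = ∑ L ∈ Finset.univ.image g, ((Finset.univ.filter fun f => g f = L).card : ℝ) *
          (4 ^ p * (K * Real.exp (-(L : ℝ) / ξ))) := by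
        refine Finset.sum_congr rfl fun L _ => ?_
        rw [← nsmul_eq_mul, ← Finset.sum_const]
        refine Finset.sum_congr rfl fun f hf => ?_
        rw [(Finset.mem_filter.1 hf).2]
    _ ≤ ∑ L ∈ Finset.univ.image g, ((4 * Λ.card * p) ^ p * (4 ^ p * K) *
          ((5 + 4 * ξ * d) * T) ^ (d * p)) * Real.exp (-1 / (2 * ξ)) ^ L := by
        refine Finset.sum_le_sum fun L _ => ?_
        calc _ ≤ ((4 * Λ.card * p) ^ p * (2 * (2 * ℓ + L) + 1) ^ (d * p)) *
              (4 ^ p * (K * Real.exp (-(L : ℝ) / ξ))) := by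
              gcongr
              exact hcount L
          _ = ((4 * Λ.card * p) ^ p * (4 ^ p * K)) *
              ((2 * (2 * ℓ + L) + 1) ^ (d * p) * Real.exp (-(L : ℝ) / ξ)) := by ring
          _ ≤ ((4 * Λ.card * p) ^ p * (4 ^ p * K)) * (((5 + 4 * ξ * d) * T) ^ (d * p) *
              Real.exp (-1 / (2 * ξ)) ^ L) := by
              refine mul_le_mul_of_nonneg_left ?_ (by positivity)
              exact pow_mul_exp_neg_le hξ hd hp (le_max_left _ _) (le_max_right _ _) L
          _ = _ := by ring
    -- Only finitely many gaps occur; the full geometric series, with sum `A`, bounds them.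
    _ ≤ (4 * Λ.card * p) ^ p * (4 ^ p * K) * ((5 + 4 * ξ * d) * T) ^ (d * p) * A := by
        rw [← Finset.mul_sum]
        gcongr
        have h0 : 0 ≤ Real.exp (-1 / (2 * ξ)) := (Real.exp_pos _).le
        have h1 : Real.exp (-1 / (2 * ξ)) < 1 := by
          rw [Real.exp_lt_one_iff]
          exact div_neg_of_neg_of_pos (by norm_num) (by positivity)
        rw [hA, ← tsum_geometric_of_lt_one h0 h1]
        exact (summable_geometric_of_lt_one h0 h1).sum_le_tsum _ fun _ _ => by positivity
    -- The 16 combines a 4 from counting with a 4 from the norms `2 ^ (2 p)`.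
    _ = (16 * (5 + 4 * ξ * d) ^ d * (Λ.card * (p * T ^ d))) ^ p * (K * A) := by
        have h16 : (16 : ℝ) ^ p = 4 ^ p * 4 ^ p := by rw [← mul_pow]; norm_num
        simp only [mul_pow, h16, ← pow_mul]
        ring
    _ ≤ (16 * (5 + 4 * ξ * d) ^ d * (Λ.card * (p * T ^ d))) ^ p * (K * A) ^ p := by
        gcongr
        -- `K A ≥ 1` may be raised to the power `p`, so that the whole bound is a `p`-th power.
        exact le_self_pow₀ (one_le_mul_of_one_le_of_one_le hK1 hA1) (by omega)
    _ = _ := by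
        rw [← mul_pow, momentConstant]
        congr 1
        ring

end Moments

/-- Provides the moment order; `1 / 2` is the threshold at which `2 ^ 0` still satisfies the upper
bound. -/
theorem exists_two_pow_between {x : ℝ} (hx : 1 / 2 ≤ x) :
    ∃ k : ℕ, x ≤ 2 ^ k ∧ (2 : ℝ) ^ k ≤ 2 * x := by
  rcases le_total x 1 with h | h
  · exact ⟨0, by simpa using h, by rw [pow_zero]; linarith⟩
  · obtain ⟨k, hk1, hk2⟩ := exists_nat_pow_near h one_lt_two
    exact ⟨k + 1, hk2.le, by rw [pow_succ']; linarith⟩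

/-! ### Eigenstates against the canonical state and the ground-state average -/

section Eigenstates

variable {d : ℕ} {m : Fin d → ℕ} {Λ : Finset (Site m)} {q : ℕ} {H : Operator Λ q}

theorem expectation_smul (ψ : State Λ q) (c : ℂ) (O : Operator Λ q) :
    expectation ψ (c • O) = c * expectation ψ O := by
  unfold expectation
  rw [map_smul, LinearMap.smul_apply, inner_smul_right]

theorem expectation_sub_smul_one {ψ : State Λ q} (hψ : ‖ψ‖ = 1) (O : Operator Λ q) (c : ℂ) :
    expectation ψ (O - c • 1) = expectation ψ O - c := by
  unfold expectation
  rw [map_sub, map_smul, LinearMap.sub_apply, LinearMap.smul_apply, toEuclideanLin_one_apply,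
    inner_sub_right, inner_smul_right, inner_self_eq_norm_sq_to_K, hψ]
  simp

theorem expectation_smul_state (ψ : State Λ q) (c : ℂ) (hc : ‖c‖ = 1) (O : Operator Λ q) :
    expectation (c • ψ) O = expectation ψ O := by
  unfold expectation
  rw [map_smul, inner_smul_left, inner_smul_right, ← mul_assoc, ← Complex.normSq_eq_conj_mul_self,
    Complex.normSq_eq_norm_sq, hc]
  simp

theorem IsEigenstate.isEnergy {E : ℝ} {ψ : State Λ q} (h : IsEigenstate H E ψ) : IsEnergy H E := by
  refine Module.End.hasEigenvalue_of_hasEigenvector (x := ψ)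
    ⟨Module.End.mem_eigenspace_iff.2 h.2, fun h0 => ?_⟩
  have := h.1
  rw [h0, norm_zero] at this
  exact zero_ne_one this

theorem isEigenstate_groundSpace_basis (H : Operator Λ q) (k) :
    IsEigenstate H 0 (stdOrthonormalBasis ℂ (groundSpace H) k : State Λ q) := by
  refine ⟨(stdOrthonormalBasis ℂ (groundSpace H)).orthonormal.1 k, ?_⟩
  have h : Matrix.toEuclideanLin H _ = (0 : ℂ) • _ := Module.End.mem_eigenspace_iff.1
    (stdOrthonormalBasis ℂ (groundSpace H) k).2
  rw [h, Complex.ofReal_zero]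

theorem IsLocalHamiltonian.finrank_groundSpace_pos {ℓ₀ : ℕ} (hH : IsLocalHamiltonian ℓ₀ H) :
    0 < Module.finrank ℂ (groundSpace H) := by
  have h : Module.End.HasEigenvalue (Matrix.toEuclideanLin H) ((0 : ℝ) : ℂ) := hH.2.2.1
  rw [Complex.ofReal_zero] at h
  have : Nontrivial (groundSpace H) := Submodule.nontrivial_iff_ne_bot.2 h
  exact Module.finrank_pos

theorem IsEigenstate.inner_eq_zero (hH : H.IsHermitian) {E F : ℝ} {ψ φ : State Λ q}
    (hψ : IsEigenstate H E ψ) (hφ : IsEigenstate H F φ) (hne : E ≠ F) : inner ℂ ψ φ = 0 := by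
  have h := inner_toEuclideanLin_right H ψ φ
  rw [hH.eq, hψ.2, hφ.2, inner_smul_left, inner_smul_right, Complex.conj_ofReal] at h
  have h2 : ((F : ℂ) - E) * inner ℂ ψ φ = 0 := by rw [sub_mul, h, sub_self]
  refine (mul_eq_zero.1 h2).resolve_left fun h0 => hne ?_
  exact_mod_cast (sub_eq_zero.1 h0).symm

/-- The two eigenvectors give `Z ≥ e^{-βE} + 1`, hence `e^{βE} Z ≥ 1 + e^{βE} ≥ 2`. -/
theorem log_two_le_of_orthogonal (hH : H.IsHermitian) {β E : ℝ} (hβE : 0 ≤ β * E)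
    {ψ φ : State Λ q} (hψ : IsEigenstate H E ψ) (hφ : IsEigenstate H 0 φ)
    (h0 : inner ℂ ψ φ = 0) : Real.log 2 ≤ β * E + Real.log (partitionFunction H β) := by
  have hv : Orthonormal ℂ ![ψ, φ] := by
    refine ⟨fun i => ?_, fun i j hij => ?_⟩
    · fin_cases i
      · exact hψ.1
      · exact hφ.1
    · fin_cases i <;> fin_cases j
      · exact (hij rfl).elim
      · exact h0
      · exact inner_eq_zero_symm.1 h0
      · exact (hij rfl).elim
  have h1 := sum_exp_le_partitionFunction hH β hv (E := ![E, 0]) (by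
    intro k
    fin_cases k
    · exact hψ
    · exact hφ)
  simp only [Fin.sum_univ_two, Matrix.cons_val_zero, Matrix.cons_val_one, mul_zero, neg_zero,
    Real.exp_zero] at h1
  have hZ : 0 < partitionFunction H β := by linarith [Real.exp_pos (-(β * E))]
  rw [← Real.log_exp (β * E), ← Real.log_mul (Real.exp_pos _).ne' hZ.ne']
  refine Real.log_le_log two_pos ?_
  calc (2 : ℝ) ≤ 1 + Real.exp (β * E) := by linarith [Real.one_le_exp hβE]
    _ = Real.exp (β * E) * (Real.exp (-(β * E)) + 1) := by
        rw [mul_add, ← Real.exp_add, add_neg_cancel, Real.exp_zero, mul_one]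
    _ ≤ _ := by gcongr

theorem canonicalState_isHermitian (hH : H.IsHermitian) (β : ℝ) :
    (canonicalState H β).IsHermitian := by
  have h : (NormedSpace.exp (-(β : ℂ) • H)).IsHermitian := by
    have := isHermitian_exp_half_smul hH (2 * β)
    rwa [mul_div_cancel_left₀ _ two_ne_zero] at this
  unfold Matrix.IsHermitian canonicalState
  rw [Matrix.conjTranspose_smul, h.eq]
  simp

/-- An eigenstate reproduces the canonical expectation of a macroscopic observable, up to an error
controlled by the clustering of the canonical state. -/
theorem norm_expectation_sub_trace_le (hd : 1 ≤ d) (hq : 0 < q) (hH : H.IsHermitian) {β r ξ : ℝ}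
    (hξ : 0 < ξ) (hρ : IsClustering r ξ (canonicalState H β)) {ℓ : ℕ} {Ω : Operator Λ q}
    (hΩ : IsMacroscopicObservable ℓ Ω) {E : ℝ} {ψ : State Λ q} (hψ : IsEigenstate H E ψ) {x : ℝ}
    (hx : 1 / 2 ≤ x) (hEx : β * E + Real.log (partitionFunction H β) ≤ x) :
    ‖expectation ψ Ω - Matrix.trace (canonicalState H β * Ω)‖
      ≤ Real.sqrt (Real.exp 1 * momentConstant d r ξ * Λ.card) *
        max ((2 * x) ^ (((d : ℝ) + 1) / 2)) ((2 * ((ℓ : ℝ) ^ d * x)) ^ ((1 : ℝ) / 2)) := by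
  have hZ : 0 < partitionFunction H β := (Real.exp_pos _).trans_le (exp_le_partitionFunction hH β hψ)
  obtain ⟨hΩh, a, ha, rfl⟩ := hΩ
  set ρ := canonicalState H β with hρdef
  have hρn : ∀ A, ‖Matrix.trace (ρ * A)‖ ≤ ‖A‖ := norm_trace_canonicalState_mul_le hH hZ
  set Y : Λ → Operator Λ q := fun i => a i - Matrix.trace (ρ * a i) • 1 with hY
  have hYs : ∀ i, SupportedOn (ball i ℓ) (Y i) := fun i =>
    (ha i).1.sub (supportedOn_smul_one _ _)
  have hYn : ∀ i, ‖Y i‖ ≤ 2 := by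
    intro i
    have h1 : ‖Matrix.trace (ρ * a i) • (1 : Operator Λ q)‖ ≤ 1 * 1 := by
      rw [norm_smul]
      exact mul_le_mul ((hρn _).trans (ha i).2) (norm_one_le hq) (norm_nonneg _) zero_le_one
    calc ‖Y i‖ ≤ ‖a i‖ + _ := norm_sub_le _ _
      _ ≤ 2 := by linarith [(ha i).2]
  have hY0 : ∀ i, Matrix.trace (ρ * Y i) = 0 := by
    intro i
    rw [hY]
    simp only [mul_sub, Matrix.trace_sub, mul_smul_comm, mul_one, Matrix.trace_smul]
    rw [trace_canonicalState hH hZ, smul_eq_mul, mul_one, sub_self]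
  have hsum : ∑ i, Y i = ∑ i, a i - Matrix.trace (ρ * ∑ i, a i) • 1 := by
    rw [Finset.mul_sum, Matrix.trace_sum, Finset.sum_smul, ← Finset.sum_sub_distrib]
  -- The single terms need not be Hermitian; only the sum is, because `tr (ρ Ω)` is real.
  have hYh : (∑ i, Y i).IsHermitian := by
    rw [hsum]
    refine hΩh.sub ?_
    have hre : star (Matrix.trace (ρ * ∑ i, a i)) = Matrix.trace (ρ * ∑ i, a i) := by
      rw [← Matrix.trace_conjTranspose, Matrix.conjTranspose_mul, hΩh.eq,
        (canonicalState_isHermitian hH β).eq, Matrix.trace_mul_comm]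
    unfold Matrix.IsHermitian
    rw [Matrix.conjTranspose_smul, hre, Matrix.conjTranspose_one]
  rw [← expectation_sub_smul_one hψ.1, ← hsum]
  obtain ⟨k, hk1, hk2⟩ := exists_two_pow_between hx
  set p : ℕ := 2 ^ k with hp
  have hp1 : 1 ≤ p := Nat.one_le_two_pow
  have hpx : x ≤ (p : ℝ) := by rw [hp]; exact_mod_cast hk1
  have hpx2 : (p : ℝ) ≤ 2 * x := by rw [hp]; exact_mod_cast hk2
  have hx0 : 0 ≤ x := by linarith
  have hmom := hρ.norm_trace_sum_pow_le hd hq hξ hρn hYs hYn hY0 hp1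
  have hexp := norm_expectation_pow_le (β := β) hH hψ hYh k
  have hC : 0 ≤ momentConstant d r ξ := zero_le_one.trans (one_le_momentConstant d r hξ)
  set B : ℝ := max ((2 * x) ^ (((d : ℝ) + 1) / 2)) ((2 * ((ℓ : ℝ) ^ d * x)) ^ ((1 : ℝ) / 2))
    with hB
  have hB0 : 0 ≤ B := le_max_of_le_left (by positivity)
  -- The regimes `ℓ ≤ p` and `p ≤ ℓ` produce the two arguments of the maximum.
  have hTB : (p : ℝ) * ((max ℓ p : ℕ) : ℝ) ^ d ≤ B ^ 2 := by
    rcases le_total ℓ p with h | h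
    · rw [max_eq_right h, ← pow_succ']
      calc (p : ℝ) ^ (d + 1) ≤ (2 * x) ^ (d + 1) := by gcongr
        _ = ((2 * x) ^ (((d : ℝ) + 1) / 2)) ^ 2 := by
            rw [← Real.rpow_natCast, ← Real.rpow_mul_natCast (by positivity)]
            congr 1
            push_cast
            ring
        _ ≤ B ^ 2 := by
            gcongr
            exact le_max_left _ _
    · rw [max_eq_left h]
      calc (p : ℝ) * (ℓ : ℝ) ^ d ≤ (2 * x) * (ℓ : ℝ) ^ d := by gcongr
        _ = ((2 * ((ℓ : ℝ) ^ d * x)) ^ ((1 : ℝ) / 2)) ^ 2 := by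
            rw [← Real.rpow_mul_natCast (by positivity)]
            norm_num
            ring
        _ ≤ B ^ 2 := by
            gcongr
            exact le_max_right _ _
  -- The weight of the eigenstate costs only a factor `e` after the `p`-th root.
  have hfac : Real.exp (β * E) * partitionFunction H β ≤ Real.exp 1 ^ p := by
    rw [← Real.exp_log hZ, ← Real.exp_add, ← Real.exp_nat_mul, mul_one]
    exact Real.exp_le_exp.2 (hEx.trans hpx)
  have hsq : ‖expectation ψ (∑ i, Y i)‖ ^ 2
      ≤ Real.exp 1 * momentConstant d r ξ * Λ.card * B ^ 2 := by
    refine le_of_pow_le_pow_left₀ (n := p) (by omega) (by positivity) ?_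
    calc (‖expectation ψ (∑ i, Y i)‖ ^ 2) ^ p = ‖expectation ψ (∑ i, Y i)‖ ^ (2 * p) :=
          (pow_mul _ _ _).symm
      _ ≤ _ := hexp
      _ ≤ Real.exp 1 ^ p *
          (momentConstant d r ξ * (Λ.card * (p * (max ℓ p : ℕ) ^ d))) ^ p := by gcongr
      _ ≤ Real.exp 1 ^ p * (momentConstant d r ξ * (Λ.card * B ^ 2)) ^ p := by gcongr
      _ = _ := by rw [← mul_pow]; ring
  calc ‖expectation ψ (∑ i, Y i)‖ ≤ Real.sqrt (Real.exp 1 * momentConstant d r ξ * Λ.card * B ^ 2) :=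
        Real.le_sqrt_of_sq_le hsq
    _ = _ := by rw [Real.sqrt_mul (by positivity), Real.sqrt_sq hB0]

/-- If the ground state is unique, it is the ground-state average. -/
theorem expectation_eq_groundAverage {ψ : State Λ q} (hψ : IsEigenstate H 0 ψ)
    (hD : Module.finrank ℂ (groundSpace H) = 1) (O : Operator Λ q) :
    expectation ψ O = groundAverage H O := by
  have hmem : ψ ∈ groundSpace H := Module.End.mem_eigenspace_iff.2 (by simpa using hψ.2)
  set b := stdOrthonormalBasis ℂ (groundSpace H) with hb
  let k0 : Fin (Module.finrank ℂ (groundSpace H)) := ⟨0, by omega⟩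
  have : Subsingleton (Fin (Module.finrank ℂ (groundSpace H))) := by
    rw [hD]
    infer_instance
  -- In a one-dimensional ground space `ψ` is a phase times the basis vector.
  have h1 := b.sum_repr' ⟨ψ, hmem⟩
  rw [Fintype.sum_subsingleton _ k0] at h1
  have h2 : ψ = (inner ℂ (b k0) (⟨ψ, hmem⟩ : groundSpace H) : ℂ) • (b k0 : State Λ q) :=
    (congrArg Subtype.val h1).symm
  set c : ℂ := inner ℂ (b k0) (⟨ψ, hmem⟩ : groundSpace H) with hc
  have hbn : ‖(b k0 : State Λ q)‖ = 1 := (isEigenstate_groundSpace_basis H k0).1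
  have hcn : ‖c‖ = 1 := by
    have h3 := hψ.1
    rw [h2, norm_smul, hbn, mul_one] at h3
    exact h3
  unfold groundAverage
  have hDc : (Module.finrank ℂ (groundSpace H) : ℂ) = 1 := by exact_mod_cast hD
  rw [Fintype.sum_subsingleton _ k0, hDc, inv_one, one_mul]
  conv_lhs => rw [h2]
  exact expectation_smul_state _ _ hcn _

theorem norm_groundAverage_sub_le (hD : 0 < Module.finrank ℂ (groundSpace H)) {O : Operator Λ q}
    {μ : ℂ} {c : ℝ} (h : ∀ φ : State Λ q, IsEigenstate H 0 φ → ‖expectation φ O - μ‖ ≤ c) :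
    ‖groundAverage H O - μ‖ ≤ c := by
  unfold groundAverage
  set D := Module.finrank ℂ (groundSpace H) with hDdef
  have hD0 : (D : ℂ) ≠ 0 := by exact_mod_cast hD.ne'
  have h1 : (D : ℂ)⁻¹ * ∑ k, expectation (stdOrthonormalBasis ℂ (groundSpace H) k : State Λ q) O - μ
      = (D : ℂ)⁻¹ * ∑ k,
        (expectation (stdOrthonormalBasis ℂ (groundSpace H) k : State Λ q) O - μ) := by
    rw [Finset.sum_sub_distrib, Finset.sum_const, Finset.card_univ, Fintype.card_fin, nsmul_eq_mul,
      mul_sub, inv_mul_cancel_left₀ hD0]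
  have hDr : (0 : ℝ) < D := by exact_mod_cast hD
  rw [h1, norm_mul, norm_inv, Complex.norm_natCast, inv_mul_le_iff₀ hDr]
  refine (norm_sum_le_of_le _ fun k _ => h _ (isEigenstate_groundSpace_basis H k)).trans ?_
  simp [← hDdef]

/-- The distance of an eigenstate from the ground-state average. -/
theorem norm_expectation_sub_groundAverage_le (hd : 1 ≤ d) (hq : 0 < q) {ℓ₀ : ℕ}
    (hH : IsLocalHamiltonian ℓ₀ H) (hΛ : Λ.Nonempty) {β r ξ : ℝ} (hβ : 0 ≤ β)
    (hξ : 0 < ξ) (hρ : IsClustering r ξ (canonicalState H β)) {ℓ : ℕ} {Ω : Operator Λ q}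
    (hΩ : IsMacroscopicObservable ℓ Ω) {E : ℝ} {ψ : State Λ q} (hψ : IsEigenstate H E ψ) :
    0 ≤ β * E ∧ 0 ≤ Real.log (partitionFunction H β) ∧
    ‖expectation ψ ((Λ.card : ℂ)⁻¹ • Ω) - groundAverage H ((Λ.card : ℂ)⁻¹ • Ω)‖
      ≤ (1 / Real.sqrt Λ.card) * (2 * Real.sqrt (Real.exp 1 * momentConstant d r ξ) *
        max ((2 * (β * E + Real.log (partitionFunction H β))) ^ (((d : ℝ) + 1) / 2))
          ((2 * ((ℓ : ℝ) ^ d * (β * E + Real.log (partitionFunction H β)))) ^ ((1 : ℝ) / 2))) := by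
  have hE0 : 0 ≤ E := hH.2.2.2 hψ.isEnergy
  have hD := hH.finrank_groundSpace_pos
  set b := stdOrthonormalBasis ℂ (groundSpace H) with hb
  let k0 : Fin (Module.finrank ℂ (groundSpace H)) := ⟨0, hD⟩
  have hφ : IsEigenstate H 0 (b k0 : State Λ q) := isEigenstate_groundSpace_basis H k0
  have hZ1 : 1 ≤ partitionFunction H β := by
    simpa using exp_le_partitionFunction hH.1 β hφ
  have hlog : 0 ≤ Real.log (partitionFunction H β) := Real.log_nonneg hZ1
  have hβE : 0 ≤ β * E := mul_nonneg hβ hE0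
  refine ⟨hβE, hlog, ?_⟩
  set x := β * E + Real.log (partitionFunction H β) with hx
  have hx0 : 0 ≤ x := add_nonneg hβE hlog
  -- The unique ground state is set aside because `x` has no positive lower bound there.
  by_cases huniq : E = 0 ∧ Module.finrank ℂ (groundSpace H) = 1
  · rw [huniq.1] at hψ
    rw [expectation_eq_groundAverage hψ huniq.2, sub_self, norm_zero]
    positivity
  have hxlog : Real.log 2 ≤ x := by
    by_cases hE : E = 0
    · subst hE
      have hD2 : 2 ≤ Module.finrank ℂ (groundSpace H) := by
        have : Module.finrank ℂ (groundSpace H) ≠ 1 := fun h => huniq ⟨rfl, h⟩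
        omega
      let k1 : Fin (Module.finrank ℂ (groundSpace H)) := ⟨1, hD2⟩
      have h01 : inner ℂ (b k1 : State Λ q) (b k0 : State Λ q) = 0 :=
        b.orthonormal.2 (by simp [k0, k1])
      exact log_two_le_of_orthogonal hH.1 hβE (isEigenstate_groundSpace_basis H k1) hφ h01
    · exact log_two_le_of_orthogonal hH.1 hβE hψ hφ (hψ.inner_eq_zero hH.1 hφ hE)
  have hxhalf : 1 / 2 ≤ x := by linarith [Real.log_two_gt_d9]
  set μ := Matrix.trace (canonicalState H β * Ω) with hμ
  set M := max ((2 * x) ^ (((d : ℝ) + 1) / 2)) ((2 * ((ℓ : ℝ) ^ d * x)) ^ ((1 : ℝ) / 2)) with hM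
  have h1 := norm_expectation_sub_trace_le hd hq hH.1 hξ hρ hΩ hψ hxhalf le_rfl
  -- The same `x` serves for all ground states, since their own value `log Z` is at most `x`; both
  -- comparisons then share one bound.
  have h2 := norm_groundAverage_sub_le hD fun φ hφ =>
    norm_expectation_sub_trace_le hd hq hH.1 hξ hρ hΩ hφ hxhalf (by rw [mul_zero]; linarith)
  have h3 : expectation ψ ((Λ.card : ℂ)⁻¹ • Ω) - groundAverage H ((Λ.card : ℂ)⁻¹ • Ω)
      = (Λ.card : ℂ)⁻¹ * ((expectation ψ Ω - μ) - (groundAverage H Ω - μ)) := by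
    have h4 : groundAverage H ((Λ.card : ℂ)⁻¹ • Ω) = (Λ.card : ℂ)⁻¹ * groundAverage H Ω := by
      unfold groundAverage
      simp only [expectation_smul, ← Finset.mul_sum]
      ring
    rw [expectation_smul, h4]
    ring
  have hn : (0 : ℝ) < Λ.card := by exact_mod_cast hΛ.card_pos
  have hC : 0 ≤ momentConstant d r ξ := zero_le_one.trans (one_le_momentConstant d r hξ)
  rw [h3, norm_mul, norm_inv, Complex.norm_natCast]
  rw [Real.sqrt_mul (by positivity)] at h1 h2
  calc (Λ.card : ℝ)⁻¹ * ‖(expectation ψ Ω - μ) - (groundAverage H Ω - μ)‖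
      ≤ (Λ.card : ℝ)⁻¹ *
        (2 * (Real.sqrt (Real.exp 1 * momentConstant d r ξ) * Real.sqrt Λ.card * M)) := by
        gcongr
        refine (norm_sub_le _ _).trans ?_
        linarith
    _ = _ := by
        have hs : Real.sqrt Λ.card ≠ 0 := (Real.sqrt_pos.2 hn).ne'
        nth_rewrite 1 [← Real.mul_self_sqrt hn.le]
        field_simp

end Eigenstates

end SpinLattice

/-! ### The theorem -/

theorem theorem1 (d : ℕ) (hd : 1 ≤ d) (r ξ : ℝ) (hξ : 0 < ξ) (ℓ₀ : ℕ) :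
    -- the quantitative bound, with constants depending only on `d`, `r`, `ξ`, `ℓ₀`
    (∃ c₁ c₂ : ℝ, 0 < c₁ ∧ 0 < c₂ ∧
      ∀ (m : Fin d → ℕ) (Λ : Finset (SpinLattice.Site m)), Λ.Nonempty →
      ∀ q : ℕ, 2 ≤ q →
      ∀ H : SpinLattice.Operator Λ q, SpinLattice.IsLocalHamiltonian ℓ₀ H →
      ∀ β : ℝ, 0 ≤ β → SpinLattice.IsClustering r ξ (SpinLattice.canonicalState H β) →
      ∀ ℓ : ℕ, r ≤ (ℓ : ℝ) →
      ∀ Ω : SpinLattice.Operator Λ q, SpinLattice.IsMacroscopicObservable ℓ Ω →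
      ∀ (E : ℝ) (ψ : SpinLattice.State Λ q), SpinLattice.IsEigenstate H E ψ →
        ‖SpinLattice.expectation ψ ((Λ.card : ℂ)⁻¹ • Ω)
            - SpinLattice.groundAverage H ((Λ.card : ℂ)⁻¹ • Ω)‖
          ≤ (1 / Real.sqrt (Λ.card : ℝ)) *
            max (c₁ * (β * E + Real.log (SpinLattice.partitionFunction H β)) ^ (((d : ℝ) + 1) / 2))
              (c₂ * ((ℓ : ℝ) ^ d *
                (β * E + Real.log (SpinLattice.partitionFunction H β))) ^ ((1 : ℝ) / 2))) ∧
    -- thermalization of low-lying eigenstates when `log Z = O(1)`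
    (∀ ℓ : ℕ, r ≤ (ℓ : ℝ) → ∀ C ε : ℝ, 0 < ε → ∃ δ : ℝ, 0 < δ ∧ ∃ N : ℕ,
      ∀ (m : Fin d → ℕ) (Λ : Finset (SpinLattice.Site m)), Λ.Nonempty → N ≤ Λ.card →
      ∀ q : ℕ, 2 ≤ q →
      ∀ H : SpinLattice.Operator Λ q, SpinLattice.IsLocalHamiltonian ℓ₀ H →
      ∀ β : ℝ, 0 ≤ β → SpinLattice.IsClustering r ξ (SpinLattice.canonicalState H β) →
      Real.log (SpinLattice.partitionFunction H β) ≤ C →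
      ∀ Ω : SpinLattice.Operator Λ q, SpinLattice.IsMacroscopicObservable ℓ Ω →
      ∀ (E : ℝ) (ψ : SpinLattice.State Λ q), SpinLattice.IsEigenstate H E ψ →
      β * E ≤ δ * (Λ.card : ℝ) ^ (1 / ((d : ℝ) + 1)) →
        ‖SpinLattice.expectation ψ ((Λ.card : ℂ)⁻¹ • Ω)
            - SpinLattice.groundAverage H ((Λ.card : ℂ)⁻¹ • Ω)‖ ≤ ε) := by
  have hC1 := SpinLattice.one_le_momentConstant d r hξ
  set a : ℝ := 2 * Real.sqrt (Real.exp 1 * SpinLattice.momentConstant d r ξ) with ha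
  have ha0 : 0 < a := by positivity
  clear_value a
  refine ⟨⟨a * 2 ^ (((d : ℝ) + 1) / 2), a * 2 ^ ((1 : ℝ) / 2), by positivity, by positivity, ?_⟩, ?_⟩
  · intro m Λ hΛ q hq H hH β hβ hρ ℓ _ Ω hΩ E ψ hψ
    obtain ⟨h1, h2, h3⟩ := SpinLattice.norm_expectation_sub_groundAverage_le hd (by omega) hH hΛ hβ
      hξ hρ hΩ hψ
    refine h3.trans (le_of_eq ?_)
    rw [← ha, mul_max_of_nonneg _ _ ha0.le, Real.mul_rpow zero_le_two (add_nonneg h1 h2),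
      Real.mul_rpow zero_le_two (by positivity), mul_assoc a, mul_assoc a]
  · intro ℓ _ C ε hε
    -- Both expressions are continuous in `δ` and vanish at 0. The 4 is the 2 from the choice of `p`
    -- times the 2 in `x ≤ 2 δ t`.
    obtain ⟨δ, hδ, hδ1, hδ2⟩ : ∃ δ : ℝ, 0 < δ ∧ a * (4 * δ) ^ (((d : ℝ) + 1) / 2) ≤ ε ∧
        a * (4 * ((ℓ : ℝ) ^ d * δ)) ^ ((1 : ℝ) / 2) ≤ ε := by
      have hs : 0 < ((d : ℝ) + 1) / 2 := by positivity
      have c1 : Continuous fun δ : ℝ => a * (4 * δ) ^ (((d : ℝ) + 1) / 2) :=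
        ((continuous_const.mul continuous_id).rpow_const fun _ => Or.inr hs.le).const_mul a
      have c2 : Continuous fun δ : ℝ => a * (4 * ((ℓ : ℝ) ^ d * δ)) ^ ((1 : ℝ) / 2) :=
        ((continuous_const.mul (continuous_const.mul continuous_id)).rpow_const
          fun _ => Or.inr (by norm_num)).const_mul a
      have e1 := (c1.tendsto 0).eventually_lt_const (u := ε)
        (by rw [mul_zero, Real.zero_rpow hs.ne', mul_zero]; exact hε)
      have e2 := (c2.tendsto 0).eventually_lt_const (u := ε)
        (by rw [mul_zero, mul_zero, Real.zero_rpow (by norm_num), mul_zero]; exact hε)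
      obtain ⟨δ, ⟨h1, h2⟩, h3⟩ := (((e1.and e2).filter_mono nhdsWithin_le_nhds).and
        (self_mem_nhdsWithin (s := Set.Ioi (0 : ℝ)))).exists
      exact ⟨δ, h3, h1.le, h2.le⟩
    have hd1 : (0 : ℝ) < 1 / ((d : ℝ) + 1) := by positivity
    -- From this size on, `C ≤ δ n ^ (1 / (d + 1))`, so `log Z` is no larger than the energy
    -- allowance.
    obtain ⟨N, hN⟩ := Filter.eventually_atTop.1
      (((tendsto_rpow_atTop hd1).comp tendsto_natCast_atTop_atTop).eventually_ge_atTop (C / δ))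
    refine ⟨δ, hδ, N, ?_⟩
    intro m Λ hΛ hNΛ q hq H hH β hβ hρ hZC Ω hΩ E ψ hψ hE
    obtain ⟨h1, h2, h3⟩ := SpinLattice.norm_expectation_sub_groundAverage_le hd (by omega) hH hΛ hβ
      hξ hρ hΩ hψ
    refine h3.trans ?_
    rw [← ha]
    have hn1 : (1 : ℝ) ≤ Λ.card := by exact_mod_cast hΛ.card_pos
    have hn0 : (0 : ℝ) < Λ.card := by linarith
    set x := β * E + Real.log (SpinLattice.partitionFunction H β) with hx
    have hx0 : 0 ≤ x := add_nonneg h1 h2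
    set t : ℝ := (Λ.card : ℝ) ^ (1 / ((d : ℝ) + 1)) with ht
    have ht0 : 0 ≤ t := by positivity
    have hCt : C ≤ δ * t := by
      have := hN Λ.card hNΛ
      rwa [Function.comp_apply, div_le_iff₀' hδ] at this
    have hxt : x ≤ 2 * (δ * t) := by linarith
    -- A crude bound, sufficient for the second term, whose exponent is only `1 / 2`.
    have htn : t ≤ Λ.card := by
      calc t ≤ (Λ.card : ℝ) ^ (1 : ℝ) := by
            refine Real.rpow_le_rpow_of_exponent_le hn1 ?_
            rw [div_le_one (by positivity)]
            linarith [(Nat.cast_nonneg d : (0 : ℝ) ≤ d)]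
        _ = _ := Real.rpow_one _
    have b1 : a * (2 * x) ^ (((d : ℝ) + 1) / 2) ≤ ε * Real.sqrt Λ.card := by
      calc a * (2 * x) ^ (((d : ℝ) + 1) / 2) ≤ a * (4 * δ * t) ^ (((d : ℝ) + 1) / 2) :=
            mul_le_mul_of_nonneg_left
              (Real.rpow_le_rpow (by positivity) (by linarith) (by positivity)) ha0.le
        -- The energy scale is tuned so that `t ^ ((d + 1) / 2) = √n`, which cancels the prefactor.
        _ = a * (4 * δ) ^ (((d : ℝ) + 1) / 2) * Real.sqrt Λ.card := by
            rw [Real.mul_rpow (by positivity) ht0, ht, ← Real.rpow_mul hn0.le, Real.sqrt_eq_rpow,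
              mul_assoc]
            congr 3
            field_simp
        _ ≤ _ := by gcongr
    have b2 : a * (2 * ((ℓ : ℝ) ^ d * x)) ^ ((1 : ℝ) / 2) ≤ ε * Real.sqrt Λ.card := by
      calc a * (2 * ((ℓ : ℝ) ^ d * x)) ^ ((1 : ℝ) / 2)
          ≤ a * (2 * ((ℓ : ℝ) ^ d * (2 * (δ * Λ.card)))) ^ ((1 : ℝ) / 2) := by
            gcongr
            exact hxt.trans (by gcongr)
        _ = a * (4 * ((ℓ : ℝ) ^ d * δ)) ^ ((1 : ℝ) / 2) * Real.sqrt Λ.card := by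
            rw [Real.sqrt_eq_rpow, mul_assoc, ← Real.mul_rpow (by positivity) hn0.le]
            congr 2
            ring
        _ ≤ _ := by gcongr
    rw [mul_max_of_nonneg _ _ ha0.le, one_div, inv_mul_le_iff₀ (Real.sqrt_pos.2 hn0), mul_comm _ ε]
    exact max_le b1 b2
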